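/- Let $\mathbf{t} = t_0t_1t_2\cdots = 01101001\cdots$ be the Thue--Morse word, where $t_i \in \{0,1\}$ is the parity of the sum of the binary digits of $i$. For $n \ge 0$ let $c(n)$ be the number of length-$n$ factors (contiguous blocks $t_i t_{i+1}\cdots t_{i+n-1}$, $i \ge 0$) of $\mathbf{t}$, where factors that are equal up to a cyclic shift are counted only once. Put $$A = \{2^k - 1 : k \ge 1\}, \quad B = \{2^k + 1 : k \ge 2\}, \quad J = \{(2^{2i+1}+1)2^j : i \ge 1,\ j \ge 0\}.$$ Then: (i) $c(n) \ge \frac{4}{3} n - 4$ for all integers $n \ge 0$; (ii) $c(n) \ge \frac{4}{3} n - 2$ for all even $n \ge 0$ with $n \notin J$; (iii) $c(n) \ge \frac{4n+16}{3}$ for all odd $n \ge 47$ with $n \notin A \cup B$. -/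

import Mathlib

/-- The Thue-Morse word `t = 01101001...`: the letter `t n` is the parity of the sum of the binary
digits of `n`. -/
def thueMorse (n : ℕ) : Fin 2 := Fin.ofNat 2 (Nat.digits 2 n).sum

/-- The factor `x i, x (i + 1), ..., x (i + n - 1)` of length `n` of the infinite word `x` that
starts at position `i`. -/
def factorAt {α : Type*} (x : ℕ → α) (n i : ℕ) : List α := List.ofFn fun k : Fin n => x (i + k)

/-- The set of length-`n` factors of the infinite word `x` up to cyclic shift; `Cycle α` is the
quotient of `List α` by the relation of being a rotation of each other. -/
def cyclicFactors {α : Type*} (x : ℕ → α) (n : ℕ) : Set (Cycle α) :=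
  Set.range fun i : ℕ => (factorAt x n i : Cycle α)

/-- Over a finite alphabet the set counted by `cyclicComplexity` is finite, so that its `ncard` is
the true number of elements. -/
theorem cyclicFactors_finite {α : Type*} [Finite α] (x : ℕ → α) (n : ℕ) :
    (cyclicFactors x n).Finite := by
  refine (Set.finite_range fun v : Fin n → α => ((List.ofFn v : List α) : Cycle α)).subset ?_
  rintro _ ⟨i, rfl⟩
  exact ⟨fun k => x (i + k), rfl⟩

/-- The cyclic complexity of an infinite word over a finite alphabet: the number of its factors of
length `n`, where factors that agree up to cyclic shift are counted once. -/
noncomputable def cyclicComplexity {α : Type*} [Finite α] (x : ℕ → α) (n : ℕ) : ℕ :=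
  (cyclicFactors x n).ncard

/-- The set `{2 ^ k - 1 : k ≥ 1}`. -/
def setA : Set ℕ := {n | ∃ k : ℕ, 1 ≤ k ∧ n = 2 ^ k - 1}

/-- The set `{2 ^ k + 1 : k ≥ 2}`. -/
def setB : Set ℕ := {n | ∃ k : ℕ, 2 ≤ k ∧ n = 2 ^ k + 1}

/-- The set `{(2 ^ (2 i + 1) + 1) 2 ^ j : i ≥ 1, j ≥ 0}`. -/
def setJ : Set ℕ := {n | ∃ i j : ℕ, 1 ≤ i ∧ n = (2 ^ (2 * i + 1) + 1) * 2 ^ j}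

/-!
Every sufficiently long factor of the Thue-Morse word is uniquely divided into the blocks `01` and
`10`, the images of the letters under the morphism `mu`. This expresses the cyclic complexity `c` at
a length through data at half the length. Let `p` count the factors and `D` those with distinct
first and last letters.

At length `2 * m`, the images of the cyclic factors of length `m` are pairwise distinct, and each
factor of length `m + 1` with distinct ends gives one more cyclic factor, by removing the outer two
letters of its image. So `c m + D (m + 1) ≤ c (2 * m)`.

At length `2 * m + 1`, removing the first or the last letter of the image of a factor of length
`m + 1` gives `2 * p (m + 1)` words up to rotation. Two of them coincide only if they come from a
factor of length `m + 1` or `m + 2` with distinct ends or from a minimal forbidden word of length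
`m + 2`. There are at most four of the latter, and none unless `m` is of the form `3 * 2 ^ j`. So
`2 * p (m + 1) ≤ c (2 * m + 1) + D (m + 1) + D (m + 2) + 4`, and the `4` is only needed for these
`m`.

The value of `p` is explicit. The imbalance `2 * D - p` satisfies a linear recursion under halving
of the length, which bounds it by Jacobsthal numbers. This is too weak only near powers of two,
where the imbalance is computed or estimated separately; the sets `A`, `B` and `J` come from there.
-/

theorem isRotated_iff_exists_append {α : Type*} {u v : List α} :
    u ~r v ↔ ∃ s t, u = s ++ t ∧ v = t ++ s := by
  constructor
  · rintro ⟨n, rfl⟩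
    exact ⟨_, _, (List.take_append_drop (n % u.length) u).symm,
      List.rotate_eq_drop_append_take_mod⟩
  · rintro ⟨s, t, rfl, rfl⟩
    exact List.isRotated_append

theorem ncard_sep_image_union_image {α β : Type*} {S T : Set α} {f g : α → β} (P : β → Prop)
    (hS : S.Finite) (hT : T.Finite) (hf : S.InjOn f) (hg : T.InjOn g)
    (h : Disjoint (f '' S) (g '' T)) :
    {y ∈ f '' S ∪ g '' T | P y}.ncard =
      {x ∈ S | P (f x)}.ncard + {x ∈ T | P (g x)}.ncard := by
  have heq : {y ∈ f '' S ∪ g '' T | P y} = f '' {x ∈ S | P (f x)} ∪ g '' {x ∈ T | P (g x)} := by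
    aesop
  rw [heq, Set.ncard_union_eq _ ((hS.sep _).image f) ((hT.sep _).image g),
    (hf.mono (Set.sep_subset _ _)).ncard_image,
    (hg.mono (Set.sep_subset _ _)).ncard_image]
  exact h.mono (Set.image_mono (Set.sep_subset _ _)) (Set.image_mono (Set.sep_subset _ _))

section Factors

variable {α : Type*} {x : ℕ → α} {m n i j : ℕ} {u v w : List α}

@[simp] theorem factorAt_zero : factorAt x 0 i = [] := rfl

@[simp] theorem length_factorAt : (factorAt x n i).length = n := by simp [factorAt]

theorem factorAt_eq_factorAt_iff :
    factorAt x n i = factorAt x n j ↔ ∀ k < n, x (i + k) = x (j + k) := by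
  simp only [factorAt, List.ofFn_inj, funext_iff, Fin.forall_iff]

theorem factorAt_succ : factorAt x (n + 1) i = x i :: factorAt x n (i + 1) := by
  simp only [factorAt, List.ofFn_succ, Fin.val_zero, add_zero, Fin.val_succ, add_assoc, add_comm 1]

theorem factorAt_succ' : factorAt x (n + 1) i = factorAt x n i ++ [x (i + n)] := by
  simp only [factorAt, List.ofFn_succ', List.concat_eq_append, Fin.val_castSucc, Fin.val_last]

theorem factorAt_add : factorAt x (m + n) i = factorAt x m i ++ factorAt x n (i + m) := by
  induction n with
  | zero => simp
  | succ n ih => rw [← add_assoc, factorAt_succ', ih, factorAt_succ', List.append_assoc, add_assoc]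

@[simp] theorem tail_factorAt_succ : (factorAt x (n + 1) i).tail = factorAt x n (i + 1) := by
  rw [factorAt_succ, List.tail_cons]

@[simp] theorem dropLast_factorAt_succ : (factorAt x (n + 1) i).dropLast = factorAt x n i := by
  rw [factorAt_succ', List.dropLast_concat]

@[simp] theorem head?_factorAt_succ : (factorAt x (n + 1) i).head? = some (x i) := by
  rw [factorAt_succ, List.head?_cons]

@[simp] theorem getLast?_factorAt_succ :
    (factorAt x (n + 1) i).getLast? = some (x (i + n)) := by
  rw [factorAt_succ', List.getLast?_concat]

/-- The finite word `w` is a factor of the infinite word `x`. -/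
def IsFactor (x : ℕ → α) (w : List α) : Prop := ∃ i, factorAt x w.length i = w

theorem isFactor_factorAt : IsFactor x (factorAt x n i) := ⟨i, by rw [length_factorAt]⟩

namespace IsFactor

theorem left (h : IsFactor x (u ++ v)) : IsFactor x u := by
  obtain ⟨i, hi⟩ := h
  rw [List.length_append, factorAt_add] at hi
  exact ⟨i, (List.append_inj hi length_factorAt).1⟩

theorem right (h : IsFactor x (u ++ v)) : IsFactor x v := by
  obtain ⟨i, hi⟩ := h
  rw [List.length_append, factorAt_add] at hi
  exact ⟨_, (List.append_inj hi length_factorAt).2⟩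

theorem of_infix (h : IsFactor x v) (huv : u <:+: v) : IsFactor x u := by
  obtain ⟨s, t, rfl⟩ := huv
  exact h.left.right

end IsFactor

/-- The set of factors of length `n` of the infinite word `x`. -/
def factors (x : ℕ → α) (n : ℕ) : Set (List α) := Set.range (factorAt x n)

theorem factorAt_mem_factors : factorAt x n i ∈ factors x n := Set.mem_range_self i

theorem mem_factors_iff : w ∈ factors x n ↔ w.length = n ∧ IsFactor x w := by
  constructor
  · rintro ⟨i, rfl⟩
    exact ⟨length_factorAt, isFactor_factorAt⟩
  · rintro ⟨rfl, h⟩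
    exact h

theorem factors_eq_union : factors x n =
    Set.range (fun i => factorAt x n (2 * i)) ∪ Set.range (fun i => factorAt x n (2 * i + 1)) := by
  ext w
  constructor
  · rintro ⟨i, rfl⟩
    obtain ⟨j, rfl | rfl⟩ := i.even_or_odd'
    exacts [.inl ⟨j, rfl⟩, .inr ⟨j, rfl⟩]
  · rintro (⟨i, rfl⟩ | ⟨i, rfl⟩) <;> exact factorAt_mem_factors

theorem finite_factors [Finite α] : (factors x n).Finite :=
  (List.finite_length_eq α n).subset fun _ h => (mem_factors_iff.1 h).1

/-- The factor complexity: the number of factors of length `n` of the infinite word `x`. -/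
noncomputable def factorComplexity (x : ℕ → α) (n : ℕ) : ℕ := (factors x n).ncard

/-- The factors of length `n` whose first and last letters differ. -/
def distinctEnds (x : ℕ → α) (n : ℕ) : Set (List α) := {w ∈ factors x n | w.head? ≠ w.getLast?}

theorem factorAt_mem_distinctEnds_iff :
    factorAt x (n + 1) i ∈ distinctEnds x (n + 1) ↔ x i ≠ x (i + n) := by
  simp [distinctEnds, factorAt_mem_factors]

theorem finite_distinctEnds [Finite α] : (distinctEnds x n).Finite := finite_factors.sep _

/-- The number of factors of length `n` whose first and last letters differ. -/
noncomputable def distinctEndsComplexity (x : ℕ → α) (n : ℕ) : ℕ := (distinctEnds x n).ncard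

theorem ncard_factors_head?_eq_getLast? [Finite α] :
    {w ∈ factors x n | w.head? = w.getLast?}.ncard + distinctEndsComplexity x n =
      factorComplexity x n := by
  rw [distinctEndsComplexity, factorComplexity, ← Set.ncard_union_eq _ (finite_factors.sep _)
    finite_distinctEnds]
  · congr 1
    ext w
    by_cases h : w.head? = w.getLast? <;> simp [distinctEnds, h]
  · exact Set.disjoint_left.2 fun w heq hne => hne.2 heq.2

/-- The minimal forbidden words of length `n`: the words that are not factors of `x` although
deleting their first letter, or their last letter, leaves a factor. -/
def minimalForbidden (x : ℕ → α) (n : ℕ) : Set (List α) :=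
  {w | w.length = n ∧ IsFactor x w.dropLast ∧ IsFactor x w.tail ∧ ¬ IsFactor x w}

theorem finite_minimalForbidden [Finite α] : (minimalForbidden x n).Finite :=
  (List.finite_length_eq α n).subset fun _ h => h.1

theorem exists_of_mem_minimalForbidden (h : w ∈ minimalForbidden x (m + 2)) :
    ∃ i j, w = x i :: (factorAt x m (i + 1) ++ [x (j + m)]) ∧
      factorAt x m (i + 1) = factorAt x m j := by
  obtain ⟨hw, ⟨i, hi⟩, ⟨j, hj⟩, -⟩ := h
  obtain ⟨a, w, rfl⟩ := List.exists_cons_of_length_eq_add_one hw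
  obtain rfl | ⟨v, b, rfl⟩ := List.eq_nil_or_concat' w
  · simp at hw
  obtain rfl : v.length = m := by simpa using hw
  have hi : factorAt x (v.length + 1) i = a :: v := by
    rw [← List.cons_append, List.dropLast_concat] at hi
    exact hi
  have hj : factorAt x (v.length + 1) j = v ++ [b] := by simpa using hj
  rw [factorAt_succ, List.cons.injEq] at hi
  rw [factorAt_succ'] at hj
  obtain ⟨hj, hb⟩ := List.append_inj' hj rfl
  refine ⟨i, j, ?_, hi.2.trans hj.symm⟩
  rw [hi.1, hi.2, hb]

end Factors

namespace ThueMorse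

@[simp] theorem rev_ne (a : Fin 2) : a.rev ≠ a := by revert a; decide

@[simp] theorem ne_rev (a : Fin 2) : a ≠ a.rev := (rev_ne a).symm

theorem eq_rev_iff_ne {a b : Fin 2} : a = b.rev ↔ a ≠ b := by revert a b; decide

theorem rev_ne_iff_eq {a b : Fin 2} : a.rev ≠ b ↔ a = b := by revert a b; decide

theorem thueMorse_two_mul (i : ℕ) : thueMorse (2 * i) = thueMorse i := by
  rcases i.eq_zero_or_pos with rfl | hi
  · rfl
  · rw [thueMorse, Nat.digits_base_mul one_lt_two hi, List.sum_cons, zero_add, thueMorse]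

theorem thueMorse_two_mul_add_one (i : ℕ) :
    thueMorse (2 * i + 1) = (thueMorse i).rev := by
  have h (k : ℕ) : Fin.ofNat 2 (1 + k) = (Fin.ofNat 2 k).rev := by
    ext; simp only [Fin.val_ofNat, Fin.val_rev]; omega
  rw [thueMorse, Nat.digits_add_two_add_one, List.sum_cons, thueMorse, ← h]
  congr <;> omega

theorem thueMorse_add_one_eq_iff {i j : ℕ} (hi : Even i) (hj : Even j) :
    thueMorse (i + 1) = thueMorse (j + 1) ↔ thueMorse i = thueMorse j := by
  obtain ⟨i, rfl⟩ := hi.two_dvd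
  obtain ⟨j, rfl⟩ := hj.two_dvd
  simp only [thueMorse_two_mul, thueMorse_two_mul_add_one, Fin.rev_inj]

theorem thueMorse_not_cube (i : ℕ) :
    ¬ (thueMorse i = thueMorse (i + 1) ∧ thueMorse (i + 1) = thueMorse (i + 2)) := by
  rintro ⟨hleft, hright⟩
  obtain ⟨j, rfl | rfl⟩ := i.even_or_odd'
  · rw [thueMorse_two_mul_add_one, thueMorse_two_mul] at hleft
    exact ne_rev _ hleft
  · rw [show 2 * j + 1 + 2 = 2 * (j + 1) + 1 by ring, show 2 * j + 1 + 1 = 2 * (j + 1) by ring,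
      thueMorse_two_mul_add_one, thueMorse_two_mul] at hright
    exact ne_rev _ hright

-- Otherwise the letters of the Thue-Morse word at `j`, `j + 1` and `j + 2` agree.
theorem factorAt_two_mul_ne_factorAt_two_mul_add_one {n i j : ℕ} (hn : 4 ≤ n) :
    factorAt thueMorse n (2 * i) ≠ factorAt thueMorse n (2 * j + 1) := by
  intro h
  rw [factorAt_eq_factorAt_iff] at h
  have h0 := h 0 (by omega)
  have h1 := h 1 (by omega)
  have h2 := h 2 (by omega)
  have h3 := h 3 (by omega)
  rw [show 2 * j + 1 + 3 = 2 * (j + 2) by ring, show 2 * i + 3 = 2 * (i + 1) + 1 by ring] at h3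
  rw [show 2 * j + 1 + 2 = 2 * (j + 1) + 1 by ring, show 2 * i + 2 = 2 * (i + 1) by ring] at h2
  rw [show 2 * j + 1 + 1 = 2 * (j + 1) by ring] at h1
  simp only [add_zero, thueMorse_two_mul, thueMorse_two_mul_add_one] at h0 h1 h2 h3
  refine thueMorse_not_cube j ⟨?_, ?_⟩
  · rw [← h1, h0, Fin.rev_rev]
  · rw [← h3, h2, Fin.rev_rev]

theorem even_iff_even_of_factorAt_eq {n i j : ℕ} (hn : 4 ≤ n)
    (h : factorAt thueMorse n i = factorAt thueMorse n j) : Even i ↔ Even j := by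
  obtain ⟨i, rfl | rfl⟩ := i.even_or_odd' <;> obtain ⟨j, rfl | rfl⟩ := j.even_or_odd'
  · simp
  · exact absurd h (factorAt_two_mul_ne_factorAt_two_mul_add_one hn)
  · exact absurd h.symm (factorAt_two_mul_ne_factorAt_two_mul_add_one hn)
  · simp

/-- The Thue-Morse morphism `0 ↦ 01`, `1 ↦ 10`, the second letter of each block being the
complement `Fin.rev` of the first. The Thue-Morse word is its fixed point that begins with `0`. -/
def mu (u : List (Fin 2)) : List (Fin 2) := u.flatMap fun a => [a, a.rev]

section Morphism

variable {u v w : List (Fin 2)} {a b : Fin 2} {m n i j k : ℕ}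

@[simp] theorem mu_nil : mu [] = [] := rfl

@[simp] theorem mu_cons : mu (a :: u) = a :: a.rev :: mu u := rfl

@[simp] theorem mu_append : mu (u ++ v) = mu u ++ mu v := List.flatMap_append

@[simp] theorem length_mu : (mu u).length = 2 * u.length := by
  simp [mu, List.length_flatMap, mul_comm]

theorem tail_dropLast_mu :
    (mu (a :: (v ++ [b]))).tail.dropLast = a.rev :: (mu v ++ [b]) := by
  rw [mu_cons, List.tail_cons, mu_append, mu_cons, mu_nil,
    show a.rev :: (mu v ++ [b, b.rev]) = (a.rev :: (mu v ++ [b])) ++ [b.rev] by simp,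
    List.dropLast_concat]

theorem mu_injective : Function.Injective mu := by
  intro u v h
  induction u generalizing v with
  | nil => cases v with
    | nil => rfl
    | cons => simp at h
  | cons a u ih => cases v with
    | nil => simp at h
    | cons b v =>
      simp only [mu_cons, List.cons.injEq] at h ⊢
      exact ⟨h.1, ih h.2.2⟩

theorem count_mu : (mu u).count a = u.length := by
  induction u with
  | nil => rfl
  | cons b u ih =>
    obtain rfl | hb := eq_or_ne a b
    · simp [ih]
    · simp [ih, hb.symm, (eq_rev_iff_ne.2 hb).symm]

theorem factorAt_two_mul :
    factorAt thueMorse (2 * m) (2 * i) = mu (factorAt thueMorse m i) := by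
  induction m generalizing i with
  | zero => rfl
  | succ m ih =>
    rw [mul_add_one, factorAt_succ, factorAt_succ, factorAt_succ, add_assoc, ← mul_add_one, ih,
      thueMorse_two_mul, thueMorse_two_mul_add_one, mu_cons]

theorem factorAt_two_mul_two_mul_add_one :
    factorAt thueMorse (2 * m) (2 * i + 1) = (mu (factorAt thueMorse (m + 1) i)).tail.dropLast := by
  rw [← factorAt_two_mul, mul_add_one, tail_factorAt_succ, dropLast_factorAt_succ]

theorem factorAt_two_mul_add_one_two_mul :
    factorAt thueMorse (2 * m + 1) (2 * i) = (mu (factorAt thueMorse (m + 1) i)).dropLast := by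
  rw [← factorAt_two_mul, mul_add_one, dropLast_factorAt_succ]

theorem factorAt_two_mul_add_one_two_mul_add_one :
    factorAt thueMorse (2 * m + 1) (2 * i + 1) = (mu (factorAt thueMorse (m + 1) i)).tail := by
  rw [← factorAt_two_mul, mul_add_one, tail_factorAt_succ]

theorem _root_.IsFactor.mu (h : IsFactor thueMorse u) : IsFactor thueMorse (mu u) := by
  obtain ⟨i, hi⟩ := h
  rw [← hi, ← factorAt_two_mul]
  exact isFactor_factorAt

theorem factorAt_two_pow : factorAt thueMorse (2 ^ n) 0 = mu^[n] [0] := by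
  induction n with
  | zero => rfl
  | succ n ih =>
    rw [Function.iterate_succ_apply', ← ih, ← factorAt_two_mul, pow_succ', mul_zero]

theorem isFactor_of_infix_iterate_mu (h : w <:+: mu^[n] [0]) : IsFactor thueMorse w :=
  IsFactor.of_infix (factorAt_two_pow ▸ isFactor_factorAt) h

theorem not_isFactor_cube : ¬ IsFactor thueMorse [a, a, a] := by
  rintro ⟨i, hi⟩
  simp only [List.length_cons, List.length_nil, zero_add, factorAt_succ, List.cons.injEq] at hi
  exact thueMorse_not_cube i ⟨hi.1.trans hi.2.1.symm, hi.2.1.trans hi.2.2.1.symm⟩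

theorem not_isFactor_cons_cube : ¬ IsFactor thueMorse (a :: a :: a :: u) :=
  fun h => not_isFactor_cube (IsFactor.left (v := u) h)

theorem length_le_of_isFactor_replicate (h : IsFactor thueMorse (List.replicate k a)) :
    k ≤ 2 := by
  by_contra! hk
  obtain ⟨j, rfl⟩ := Nat.exists_eq_add_of_le' hk
  exact not_isFactor_cons_cube (by simpa only [List.replicate_succ] using h)

end Morphism

section Counting

variable {i j m n : ℕ} (P : List (Fin 2) → Prop)

theorem factorAt_eq_of_factorAt_two_mul_eq (hn : 2 * m + 1 ≤ n)
    (h : factorAt thueMorse n (2 * i) = factorAt thueMorse n (2 * j)) :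
    factorAt thueMorse (m + 1) i = factorAt thueMorse (m + 1) j := by
  rw [factorAt_eq_factorAt_iff] at h ⊢
  intro k hk
  have := h (2 * k) (by omega)
  rwa [← mul_add, ← mul_add, thueMorse_two_mul, thueMorse_two_mul] at this

theorem factorAt_eq_of_factorAt_two_mul_add_one_eq (hm : 1 ≤ m) (hn : 2 * m ≤ n)
    (h : factorAt thueMorse n (2 * i + 1) = factorAt thueMorse n (2 * j + 1)) :
    factorAt thueMorse (m + 1) i = factorAt thueMorse (m + 1) j := by
  rw [factorAt_eq_factorAt_iff] at h ⊢
  rintro (_ | k) hk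
  · simpa only [add_zero, thueMorse_two_mul_add_one, Fin.rev_inj] using h 0 (by omega)
  · have := h (2 * k + 1) (by omega)
    rwa [show 2 * i + 1 + (2 * k + 1) = 2 * (i + (k + 1)) by ring, thueMorse_two_mul,
      show 2 * j + 1 + (2 * k + 1) = 2 * (j + (k + 1)) by ring, thueMorse_two_mul] at this

theorem ncard_factors_two_mul (hm : 2 ≤ m) :
    {w ∈ factors thueMorse (2 * m) | P w}.ncard = {w ∈ factors thueMorse m | P (mu w)}.ncard +
      {w ∈ factors thueMorse (m + 1) | P (mu w).tail.dropLast}.ncard := by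
  have heq : factors thueMorse (2 * m) = mu '' factors thueMorse m ∪
      (fun w => (mu w).tail.dropLast) '' factors thueMorse (m + 1) := by
    simp_rw [factors_eq_union (n := 2 * m), factors, ← Set.range_comp, Function.comp_def,
      factorAt_two_mul, factorAt_two_mul_two_mul_add_one]
  rw [heq]
  refine ncard_sep_image_union_image P finite_factors finite_factors mu_injective.injOn ?_ ?_
  · rintro _ ⟨i, rfl⟩ _ ⟨j, rfl⟩ h
    simp only [← factorAt_two_mul_two_mul_add_one] at h
    exact factorAt_eq_of_factorAt_two_mul_add_one_eq (by omega) le_rfl h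
  · rw [Set.disjoint_left]
    rintro _ ⟨_, ⟨i, rfl⟩, rfl⟩ ⟨_, ⟨j, rfl⟩, h⟩
    exact factorAt_two_mul_ne_factorAt_two_mul_add_one (n := 2 * m) (by omega)
      (factorAt_two_mul.trans (h.symm.trans factorAt_two_mul_two_mul_add_one.symm))

theorem ncard_factors_two_mul_add_one (hm : 2 ≤ m) :
    {w ∈ factors thueMorse (2 * m + 1) | P w}.ncard =
      {w ∈ factors thueMorse (m + 1) | P (mu w).dropLast}.ncard +
      {w ∈ factors thueMorse (m + 1) | P (mu w).tail}.ncard := by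
  have heq : factors thueMorse (2 * m + 1) =
      (fun w => (mu w).dropLast) '' factors thueMorse (m + 1) ∪
      (fun w => (mu w).tail) '' factors thueMorse (m + 1) := by
    simp_rw [factors_eq_union (n := 2 * m + 1), factors, ← Set.range_comp, Function.comp_def,
      factorAt_two_mul_add_one_two_mul, factorAt_two_mul_add_one_two_mul_add_one]
  rw [heq]
  refine ncard_sep_image_union_image P finite_factors finite_factors ?_ ?_ ?_
  · rintro _ ⟨i, rfl⟩ _ ⟨j, rfl⟩ h
    simp only [← factorAt_two_mul_add_one_two_mul] at h
    exact factorAt_eq_of_factorAt_two_mul_eq le_rfl h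
  · rintro _ ⟨i, rfl⟩ _ ⟨j, rfl⟩ h
    simp only [← factorAt_two_mul_add_one_two_mul_add_one] at h
    exact factorAt_eq_of_factorAt_two_mul_add_one_eq (by omega) (by omega) h
  · rw [Set.disjoint_left]
    rintro _ ⟨_, ⟨i, rfl⟩, rfl⟩ ⟨_, ⟨j, rfl⟩, h⟩
    simp only [← factorAt_two_mul_add_one_two_mul, ← factorAt_two_mul_add_one_two_mul_add_one] at h
    exact factorAt_two_mul_ne_factorAt_two_mul_add_one (by omega) h.symm

theorem factorComplexity_two_mul (hm : 2 ≤ m) : factorComplexity thueMorse (2 * m) =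
    factorComplexity thueMorse m + factorComplexity thueMorse (m + 1) := by
  simpa only [Set.sep_true, factorComplexity] using ncard_factors_two_mul (fun _ => True) hm

theorem factorComplexity_two_mul_add_one (hm : 2 ≤ m) :
    factorComplexity thueMorse (2 * m + 1) = 2 * factorComplexity thueMorse (m + 1) := by
  rw [two_mul (factorComplexity _ _)]
  simpa only [Set.sep_true, factorComplexity] using
    ncard_factors_two_mul_add_one (fun _ => True) hm

theorem sep_factors_congr {P Q : List (Fin 2) → Prop}
    (h : ∀ i, P (factorAt thueMorse n i) ↔ Q (factorAt thueMorse n i)) :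
    {w ∈ factors thueMorse n | P w} = {w ∈ factors thueMorse n | Q w} := by
  ext w
  refine and_congr_right ?_
  rintro ⟨i, rfl⟩
  exact h i

theorem distinctEndsComplexity_two_mul (hm : 2 ≤ m) :
    distinctEndsComplexity thueMorse (2 * m) +
        (distinctEndsComplexity thueMorse m + distinctEndsComplexity thueMorse (m + 1)) =
      factorComplexity thueMorse m + factorComplexity thueMorse (m + 1) := by
  obtain ⟨k, rfl⟩ := Nat.exists_eq_add_of_le' (one_le_two.trans hm)
  rw [distinctEndsComplexity, distinctEnds, ncard_factors_two_mul _ hm,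
    ← ncard_factors_head?_eq_getLast?, ← ncard_factors_head?_eq_getLast?,
    sep_factors_congr (Q := fun w => w.head? = w.getLast?) (n := k + 1),
    sep_factors_congr (Q := fun w => w.head? = w.getLast?) (n := k + 1 + 1)]
  · ring
  · intro i
    rw [← factorAt_two_mul_two_mul_add_one, mul_add_one]
    simp only [head?_factorAt_succ, getLast?_factorAt_succ, Option.some_inj, ne_eq]
    rw [show 2 * i + 1 + (2 * k + 1) = 2 * (i + (k + 1)) by ring,
      thueMorse_two_mul, thueMorse_two_mul_add_one, ← ne_eq, rev_ne_iff_eq]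
  · intro i
    rw [← factorAt_two_mul, mul_add_one]
    simp only [head?_factorAt_succ, getLast?_factorAt_succ, Option.some_inj, ne_eq]
    rw [show 2 * i + (2 * k + 1) = 2 * (i + k) + 1 by ring,
      thueMorse_two_mul, thueMorse_two_mul_add_one, eq_rev_iff_ne, ne_eq, not_not]

theorem distinctEndsComplexity_two_mul_add_one (hm : 2 ≤ m) :
    distinctEndsComplexity thueMorse (2 * m + 1) =
      2 * distinctEndsComplexity thueMorse (m + 1) := by
  rw [distinctEndsComplexity, distinctEnds, ncard_factors_two_mul_add_one _ hm,
    sep_factors_congr (Q := fun w => w.head? ≠ w.getLast?)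
      (P := fun w => (mu w).dropLast.head? ≠ _),
    sep_factors_congr (Q := fun w => w.head? ≠ w.getLast?) (P := fun w => (mu w).tail.head? ≠ _),
    ← two_mul]
  · rfl
  · intro i
    rw [← factorAt_two_mul_add_one_two_mul_add_one]
    simp only [head?_factorAt_succ, getLast?_factorAt_succ, ne_eq, Option.some_inj]
    rw [add_right_comm, ← mul_add, thueMorse_two_mul_add_one, thueMorse_two_mul_add_one,
      Fin.rev_inj]
  · intro i
    rw [← factorAt_two_mul_add_one_two_mul]
    simp only [head?_factorAt_succ, getLast?_factorAt_succ, ne_eq, Option.some_inj]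
    rw [← mul_add, thueMorse_two_mul, thueMorse_two_mul]

end Counting

section Values

theorem factors_two : factors thueMorse 2 =
    ({[0, 0], [0, 1], [1, 0], [1, 1]} : Finset (List (Fin 2))) := by
  ext w
  rw [mem_factors_iff]
  constructor
  · rintro ⟨hw, -⟩
    obtain ⟨a, b, rfl⟩ := List.length_eq_two.1 hw
    clear hw
    revert a b
    decide
  · have h : ∀ w ∈ ({[0, 0], [0, 1], [1, 0], [1, 1]} : Finset (List (Fin 2))),
      w.length = 2 ∧ w <:+: mu^[5] [0] := by decide
    exact fun hw => (h w hw).imp_right isFactor_of_infix_iterate_mu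

theorem factors_three : factors thueMorse 3 =
    ({[0, 0, 1], [0, 1, 0], [0, 1, 1], [1, 0, 0], [1, 0, 1], [1, 1, 0]} :
      Finset (List (Fin 2))) := by
  ext w
  rw [mem_factors_iff]
  constructor
  · rintro ⟨hw, h⟩
    obtain ⟨a, b, c, rfl⟩ := List.length_eq_three.1 hw
    have hcube : ¬ (a = b ∧ b = c) := by
      rintro ⟨rfl, rfl⟩
      exact not_isFactor_cube h
    clear hw h
    revert a b c
    decide
  · have h : ∀ w ∈ ({[0, 0, 1], [0, 1, 0], [0, 1, 1], [1, 0, 0], [1, 0, 1], [1, 1, 0]} :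
      Finset (List (Fin 2))), w.length = 3 ∧ w <:+: mu^[5] [0] := by decide
    exact fun hw => (h w hw).imp_right isFactor_of_infix_iterate_mu

theorem factorComplexity_two : factorComplexity thueMorse 2 = 4 := by
  rw [factorComplexity, factors_two, Set.ncard_coe_finset]
  rfl

theorem factorComplexity_three : factorComplexity thueMorse 3 = 6 := by
  rw [factorComplexity, factors_three, Set.ncard_coe_finset]
  rfl

theorem distinctEndsComplexity_eq_card_filter {n : ℕ} {S : Finset (List (Fin 2))}
    (h : factors thueMorse n = S) :
    distinctEndsComplexity thueMorse n = (S.filter fun w => w.head? ≠ w.getLast?).card := by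
  rw [distinctEndsComplexity, distinctEnds, h, ← Set.ncard_coe_finset, Finset.coe_filter]
  rfl

theorem distinctEndsComplexity_two : distinctEndsComplexity thueMorse 2 = 2 :=
  distinctEndsComplexity_eq_card_filter factors_two

theorem distinctEndsComplexity_three : distinctEndsComplexity thueMorse 3 = 4 :=
  distinctEndsComplexity_eq_card_filter factors_three

end Values

section MinimalForbidden

variable {i j k m : ℕ}

theorem minimalForbidden_four : minimalForbidden thueMorse 4 = ∅ := by
  rw [Set.eq_empty_iff_forall_notMem]
  rintro w ⟨hw, hinit, htail, hforbidden⟩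
  obtain ⟨a, b, c, d, rfl⟩ := List.length_eq_four.1 hw
  have habc : ¬ (a = b ∧ b = c) := by
    rintro ⟨rfl, rfl⟩
    exact not_isFactor_cube hinit
  have hbcd : ¬ (b = c ∧ c = d) := by
    rintro ⟨rfl, rfl⟩
    exact not_isFactor_cube htail
  refine hforbidden (isFactor_of_infix_iterate_mu (n := 5) ?_)
  clear hw hinit htail hforbidden
  revert a b c d
  decide

theorem ncard_minimalForbidden_five_le : (minimalForbidden thueMorse 5).ncard ≤ 4 := by
  suffices h : minimalForbidden thueMorse 5 ⊆
      ({[0, 0, 1, 0, 0], [0, 1, 0, 1, 0], [1, 0, 1, 0, 1], [1, 1, 0, 1, 1]} :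
        Finset (List (Fin 2))) by
    exact (Set.ncard_le_ncard h).trans_eq (Set.ncard_coe_finset _)
  rintro w ⟨hw, hinit, htail, hforbidden⟩
  obtain ⟨a, v, rfl⟩ := List.exists_cons_of_length_eq_add_one hw
  obtain ⟨b, c, d, e, rfl⟩ := List.length_eq_four.1 (Nat.succ.inj hw)
  have habc : ¬ (a = b ∧ b = c) := by
    rintro ⟨rfl, rfl⟩
    exact not_isFactor_cons_cube hinit
  have hbcd : ¬ (b = c ∧ c = d) := by
    rintro ⟨rfl, rfl⟩
    exact not_isFactor_cons_cube htail
  have hcde : ¬ (c = d ∧ d = e) := by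
    rintro ⟨rfl, rfl⟩
    exact not_isFactor_cube (IsFactor.right (u := [b]) htail)
  replace hforbidden := mt (isFactor_of_infix_iterate_mu (n := 5)) hforbidden
  clear hw hinit htail
  revert a b c d e
  decide

-- The letters adjacent to two occurrences of a word agree where they complete a block.
theorem odd_and_even_of_not_isFactor (hm : 4 ≤ m)
    (h : factorAt thueMorse m (i + 1) = factorAt thueMorse m j)
    (hforbidden : ¬ IsFactor thueMorse
      (thueMorse i :: (factorAt thueMorse m (i + 1) ++ [thueMorse (j + m)]))) :
    Odd i ∧ Even m := by
  have hparity := even_iff_even_of_factorAt_eq hm h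
  rw [factorAt_eq_factorAt_iff] at h
  have hi : Odd i := by
    by_contra hi
    rw [Nat.not_odd_iff_even] at hi
    obtain ⟨j, rfl⟩ : ∃ l, j = l + 1 := Nat.exists_eq_add_one.2 (by grind)
    have hletter := (thueMorse_add_one_eq_iff hi (by grind)).1 (h 0 (by omega))
    rw [hletter, factorAt_eq_factorAt_iff.2 h, ← factorAt_succ', ← factorAt_succ] at hforbidden
    exact hforbidden isFactor_factorAt
  refine ⟨hi, ?_⟩
  by_contra hm'
  obtain ⟨l, rfl⟩ : ∃ l, m = l + 1 := Nat.exists_eq_add_one.2 (by omega)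
  have hletter := (thueMorse_add_one_eq_iff (by grind) (by grind)).2 (h l (by omega))
  rw [add_assoc, add_assoc j] at hletter
  rw [← hletter, ← factorAt_succ', ← factorAt_succ] at hforbidden
  exact hforbidden isFactor_factorAt

theorem minimalForbidden_two_mul_add_three (hk : 2 ≤ k) :
    minimalForbidden thueMorse (2 * k + 3) = ∅ := by
  rw [Set.eq_empty_iff_forall_notMem]
  intro w hw
  obtain ⟨i, j, rfl, h⟩ := exists_of_mem_minimalForbidden hw
  have := (odd_and_even_of_not_isFactor (by omega) h hw.2.2.2).2
  grind

theorem minimalForbidden_two_mul_add_two_subset (hk : 2 ≤ k) :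
    minimalForbidden thueMorse (2 * k + 2) ⊆
      (fun z => (mu z).tail.dropLast) '' minimalForbidden thueMorse (k + 2) := by
  intro w hw
  obtain ⟨i, j, rfl, h⟩ := exists_of_mem_minimalForbidden hw
  have hi := (odd_and_even_of_not_isFactor (by omega) h hw.2.2.2).1
  have hj := even_iff_even_of_factorAt_eq (by omega) h
  obtain ⟨i, rfl⟩ := hi
  obtain ⟨j, rfl⟩ : ∃ l, j = 2 * l := even_iff_exists_two_mul.1 (by grind)
  rw [show 2 * i + 1 + 1 = 2 * (i + 1) by ring, ← mul_add, thueMorse_two_mul_add_one,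
    thueMorse_two_mul, factorAt_two_mul] at hw ⊢
  rw [show 2 * i + 1 + 1 = 2 * (i + 1) by ring, factorAt_two_mul, factorAt_two_mul,
    mu_injective.eq_iff] at h
  refine ⟨thueMorse i :: (factorAt thueMorse k (i + 1) ++ [thueMorse (j + k)]),
    ⟨by simp, ?_, ?_, ?_⟩, tail_dropLast_mu⟩
  · rw [← List.cons_append, List.dropLast_concat, ← factorAt_succ]
    exact isFactor_factorAt
  · rw [List.tail_cons, h, ← factorAt_succ']
    exact isFactor_factorAt
  · intro hz
    refine hw.2.2.2 (hz.mu.of_infix ⟨[thueMorse i], [(thueMorse (j + k)).rev], ?_⟩)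
    simp

theorem ncard_minimalForbidden_le (hm : 2 ≤ m) :
    (minimalForbidden thueMorse (m + 2)).ncard ≤ 4 := by
  induction m using Nat.strong_induction_on with
  | _ m ih =>
    obtain rfl | rfl | hm := show m = 2 ∨ m = 3 ∨ 4 ≤ m by omega
    · simp [minimalForbidden_four]
    · exact ncard_minimalForbidden_five_le
    obtain ⟨k, rfl | rfl⟩ := m.even_or_odd'
    · calc (minimalForbidden thueMorse (2 * k + 2)).ncard
        _ ≤ ((fun z => (mu z).tail.dropLast) '' minimalForbidden thueMorse (k + 2)).ncard :=
          Set.ncard_le_ncard (minimalForbidden_two_mul_add_two_subset (by omega))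
            (finite_minimalForbidden.image _)
        _ ≤ (minimalForbidden thueMorse (k + 2)).ncard :=
          Set.ncard_image_le finite_minimalForbidden
        _ ≤ 4 := ih k (by omega) (by omega)
    · simp [minimalForbidden_two_mul_add_three (show 2 ≤ k by omega)]

theorem exists_eq_three_mul_two_pow_of_minimalForbidden_nonempty (hm : 2 ≤ m)
    (h : (minimalForbidden thueMorse (m + 2)).Nonempty) : ∃ j, m = 3 * 2 ^ j := by
  induction m using Nat.strong_induction_on with
  | _ m ih =>
    obtain rfl | rfl | hm := show m = 2 ∨ m = 3 ∨ 4 ≤ m by omega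
    · simp [minimalForbidden_four] at h
    · exact ⟨0, rfl⟩
    obtain ⟨k, rfl | rfl⟩ := m.even_or_odd'
    · obtain ⟨j, rfl⟩ := ih k (by omega) (by omega)
        (h.mono (minimalForbidden_two_mul_add_two_subset (by omega))).of_image
      exact ⟨j + 1, by ring⟩
    · simp [minimalForbidden_two_mul_add_three (show 2 ≤ k by omega)] at h

end MinimalForbidden

section Conjugation

variable {u v s t : List (Fin 2)} {a b : Fin 2}

theorem mu_eq_append_of_even (h : mu u = s ++ t) (hs : Even s.length) :
    ∃ p q, u = p ++ q ∧ s = mu p ∧ t = mu q := by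
  obtain ⟨k, hk⟩ := hs
  have hlen := congrArg List.length h
  simp only [length_mu, List.length_append] at hlen
  refine ⟨u.take k, u.drop k, (List.take_append_drop k u).symm, ?_⟩
  rw [← List.take_append_drop k u, mu_append] at h
  refine (List.append_inj h ?_).imp Eq.symm Eq.symm
  rw [length_mu, List.length_take]
  omega

theorem mu_eq_append_of_odd (h : mu u = s ++ t) (hs : Odd s.length) :
    ∃ p c q, u = p ++ c :: q ∧ s = mu p ++ [c] ∧ t = c.rev :: mu q := by
  obtain rfl | ⟨s, c, rfl⟩ := List.eq_nil_or_concat' s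
  · simp at hs
  rw [List.append_assoc] at h
  obtain ⟨p, _ | ⟨d, q⟩, rfl, rfl, hq⟩ := mu_eq_append_of_even h (by
    simpa [Nat.odd_add_one] using hs)
  · simp at hq
  · simp only [mu_cons, List.singleton_append, List.cons.injEq] at hq
    obtain ⟨rfl, rfl⟩ := hq
    exact ⟨p, c, q, rfl, rfl, rfl⟩

theorem append_mu_eq_cons_mu (h : mu u ++ a :: s = a :: mu v) :
    ∃ w, u = List.replicate u.length a ∧ v = List.replicate u.length a.rev ++ w ∧ s = mu w := by
  induction u generalizing v with
  | nil => exact ⟨v, rfl, rfl, (List.cons.inj h).2⟩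
  | cons c u ih =>
    rcases v with _ | ⟨d, v⟩
    · simp at h
    simp only [mu_cons, List.cons_append, List.cons.injEq] at h
    obtain ⟨rfl, rfl, h⟩ := h
    rw [Fin.rev_rev] at h
    obtain ⟨w, hu, rfl, rfl⟩ := ih h
    exact ⟨w, by rw [List.length_cons, List.replicate_succ, ← hu],
      by rw [List.length_cons, List.replicate_succ, List.cons_append], rfl⟩

theorem eq_replicate_of_mu_concat_eq_cons_mu (h : mu u ++ [b] = a :: mu v) :
    u = List.replicate u.length a := by
  induction u generalizing v with
  | nil => rfl
  | cons c u ih =>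
    rcases v with _ | ⟨d, v⟩
    · simp at h
    simp only [mu_cons, List.cons_append, List.cons.injEq] at h
    obtain ⟨rfl, rfl, h⟩ := h
    rw [Fin.rev_rev] at h
    rw [List.length_cons, List.replicate_succ, ← ih h]

theorem eq_replicate_of_mu_eq_cons_mu_concat (h : mu u = a :: (mu v ++ [b])) :
    v = List.replicate v.length a.rev := by
  rcases u with _ | ⟨c, u⟩
  · simp at h
  simp only [mu_cons, List.cons.injEq] at h
  obtain ⟨rfl, h⟩ := h
  exact eq_replicate_of_mu_concat_eq_cons_mu h.symm

theorem mu_isRotated_mu (h : u ~r v) : mu u ~r mu v := by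
  obtain ⟨s, t, rfl, rfl⟩ := isRotated_iff_exists_append.1 h
  simp only [mu_append, List.isRotated_append]

theorem isRotated_or_eq_replicate_of_mu_isRotated (h : mu u ~r mu v) :
    u ~r v ∨ ∃ c, u = List.replicate u.length c := by
  obtain ⟨s, t, hu, hv⟩ := isRotated_iff_exists_append.1 h
  rcases Nat.even_or_odd s.length with hs | hs
  · obtain ⟨p, q, rfl, rfl, rfl⟩ := mu_eq_append_of_even hu hs
    rw [← mu_append, mu_injective.eq_iff] at hv
    exact .inl (hv ▸ List.isRotated_append)
  · obtain ⟨p, c, q, rfl, rfl, rfl⟩ := mu_eq_append_of_odd hu hs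
    have hqp : q ++ p = List.replicate (q ++ p).length c := by
      simpa only [Fin.rev_rev] using
        eq_replicate_of_mu_eq_cons_mu_concat (b := c) (a := c.rev) (u := v) (by simpa using hv)
    refine .inr ⟨c, List.eq_replicate_iff.2 ⟨rfl, fun b hb => ?_⟩⟩
    have := (List.eq_replicate_iff.1 hqp).2 b
    grind

theorem eq_or_eq_replicate_append_of_cons_cons_mu_isRotated
    (h : a :: a :: mu u ~r a :: a :: mu v) :
    u = v ∨ ∃ i j, u = List.replicate i a.rev ++ List.replicate j a := by
  obtain ⟨s, t, hu, hv⟩ := isRotated_iff_exists_append.1 h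
  rcases s with _ | ⟨b, _ | ⟨b', s⟩⟩
  · rw [List.append_nil] at hv
    rw [← hv] at hu
    exact .inl (by simpa [mu_injective.eq_iff] using hu)
  · simp only [List.cons_append, List.nil_append, List.cons.injEq] at hu
    obtain ⟨rfl, rfl⟩ := hu
    simp only [List.cons_append, List.cons.injEq, true_and] at hv
    exact .inr ⟨0, _, eq_replicate_of_mu_concat_eq_cons_mu hv.symm⟩
  simp only [List.cons_append, List.cons.injEq] at hu
  obtain ⟨rfl, rfl, hu⟩ := hu
  rcases Nat.even_or_odd s.length with hs | hs
  · obtain ⟨p, q, rfl, rfl, rfl⟩ := mu_eq_append_of_even hu hs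
    rcases q with _ | ⟨c, q⟩
    · exact .inl (by simpa [mu_injective.eq_iff] using hv.symm)
    · simp only [mu_cons, List.cons_append, List.cons.injEq] at hv
      exact absurd (hv.1.symm.trans hv.2.1) (ne_rev c)
  · obtain ⟨p, c, q, rfl, rfl, rfl⟩ := mu_eq_append_of_odd hu hs
    simp only [List.cons_append, List.cons.injEq] at hv
    obtain ⟨rfl, hv⟩ := hv
    obtain ⟨w, hq, -, hw⟩ := append_mu_eq_cons_mu hv.symm
    have hp := eq_replicate_of_mu_eq_cons_mu_concat hw.symm
    refine .inr ⟨p.length + 1, q.length, ?_⟩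
    rw [Fin.rev_rev] at hp ⊢
    rw [← hq, List.replicate_succ', List.append_assoc, ← hp, List.singleton_append]

end Conjugation

section EvenLength

variable {m : ℕ} {u v : List (Fin 2)} {a b : Fin 2}

/-- The map induced by the Thue-Morse morphism on cyclic words. -/
def cycleMu : Cycle (Fin 2) → Cycle (Fin 2) := Quotient.map mu fun _ _ => mu_isRotated_mu

theorem injOn_cycleMu (hm : 3 ≤ m) : (cyclicFactors thueMorse m).InjOn cycleMu := by
  rintro _ ⟨i, rfl⟩ _ ⟨j, rfl⟩ h
  refine Cycle.coe_eq_coe.2 ((isRotated_or_eq_replicate_of_mu_isRotated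
    (Cycle.coe_eq_coe.1 h)).resolve_right ?_)
  rintro ⟨c, hc⟩
  have := length_le_of_isFactor_replicate (hc ▸ isFactor_factorAt)
  rw [length_factorAt] at this
  omega

theorem not_isFactor_replicate_append_replicate {i j : ℕ} (h : 5 ≤ i + j) :
    ¬ IsFactor thueMorse (List.replicate i a ++ List.replicate j b) := by
  intro hf
  have := length_le_of_isFactor_replicate hf.left
  have := length_le_of_isFactor_replicate hf.right
  omega

theorem exists_of_mem_distinctEnds (h : u ∈ distinctEnds thueMorse (m + 2)) :
    ∃ a v, v.length = m ∧ u = a.rev :: (v ++ [a]) ∧ IsFactor thueMorse u := by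
  obtain ⟨⟨i, rfl⟩, -⟩ := id h
  rw [factorAt_mem_distinctEnds_iff, ← eq_rev_iff_ne] at h
  refine ⟨thueMorse (i + (m + 1)), factorAt thueMorse m (i + 1), length_factorAt, ?_,
    isFactor_factorAt⟩
  rw [factorAt_succ, factorAt_succ', h, add_right_comm, add_assoc]

theorem injOn_coe_tail_dropLast_mu (hm : 5 ≤ m) :
    (distinctEnds thueMorse (m + 2)).InjOn fun z => ((mu z).tail.dropLast : Cycle (Fin 2)) := by
  intro z hz z' hz' h
  obtain ⟨a, v, hv, rfl, hf⟩ := exists_of_mem_distinctEnds hz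
  obtain ⟨b, w, hw, rfl, hf'⟩ := exists_of_mem_distinctEnds hz'
  simp only [tail_dropLast_mu, Fin.rev_rev, Cycle.coe_eq_coe] at h
  obtain rfl : a = b := by
    by_contra hab
    have := h.perm.count_eq a
    simp [count_mu, hv, hw, Ne.symm hab] at this
    omega
  have hvw : a :: a :: mu v ~r a :: a :: mu w :=
    (List.isRotated_concat a (a :: mu v)).symm.trans
      (h.trans (List.isRotated_concat a (a :: mu w)))
  obtain rfl | ⟨i, j, rfl⟩ := eq_or_eq_replicate_append_of_cons_cons_mu_isRotated hvw
  · rfl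
  · refine absurd (hf.of_infix ⟨[a.rev], [a], by simp⟩)
      (not_isFactor_replicate_append_replicate (i := i) (j := j) (a := a.rev) (b := a) ?_)
    simpa [← hv] using hm

theorem cyclicComplexity_add_distinctEndsComplexity_le (hm : 6 ≤ m) :
    cyclicComplexity thueMorse m + distinctEndsComplexity thueMorse (m + 1) ≤
      cyclicComplexity thueMorse (2 * m) := by
  obtain ⟨l, rfl⟩ := Nat.exists_eq_add_of_le' (show 1 ≤ m by omega)
  rw [cyclicComplexity, ← (injOn_cycleMu (by omega)).ncard_image, distinctEndsComplexity,
    ← (injOn_coe_tail_dropLast_mu (by omega)).ncard_image, ← Set.ncard_union_eq _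
    ((cyclicFactors_finite _ _).image _) (finite_distinctEnds.image _)]
  · refine Set.ncard_le_ncard (Set.union_subset ?_ ?_) (cyclicFactors_finite _ _)
    · rintro _ ⟨_, ⟨i, rfl⟩, rfl⟩
      exact ⟨2 * i, congrArg _ factorAt_two_mul⟩
    · rintro _ ⟨_, ⟨⟨i, rfl⟩, -⟩, rfl⟩
      exact ⟨2 * i + 1, congrArg _ factorAt_two_mul_two_mul_add_one⟩
  · rw [Set.disjoint_left]
    rintro _ ⟨_, ⟨i, rfl⟩, rfl⟩ ⟨z, hz, h⟩
    obtain ⟨a, v, hv, rfl, -⟩ := exists_of_mem_distinctEnds hz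
    simp only [tail_dropLast_mu, Fin.rev_rev] at h
    have := (Cycle.coe_eq_coe.1 h).perm.count_eq a
    simp [count_mu, hv] at this

end EvenLength

section OddLength

variable {m k : ℕ} {u v s t : List (Fin 2)} {a b : Fin 2}

theorem exists_eq_replicate_of_cons_mu_eq_append (hu : a :: mu u = s ++ t)
    (hv : a :: mu v = t ++ s) (hs : Odd s.length) :
    ∃ p k, u = p ++ List.replicate k a ∧ v = List.replicate k a.rev ++ p := by
  rcases s with _ | ⟨b, s⟩
  · simp at hs
  simp only [List.cons_append, List.cons.injEq] at hu
  obtain ⟨rfl, hu⟩ := hu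
  rw [List.length_cons, Nat.odd_add_one, Nat.not_odd_iff_even] at hs
  obtain ⟨p, q, rfl, rfl, rfl⟩ := mu_eq_append_of_even hu hs
  obtain ⟨w, hq, hv, hp⟩ := append_mu_eq_cons_mu hv.symm
  rw [← mu_injective hp] at hv
  exact ⟨p, q.length, by rw [← hq], hv⟩

theorem exists_eq_replicate_of_cons_mu_isRotated (h : a :: mu u ~r a :: mu v) :
    ∃ p k, (u = p ++ List.replicate k a ∧ v = List.replicate k a.rev ++ p) ∨
      (v = p ++ List.replicate k a ∧ u = List.replicate k a.rev ++ p) := by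
  obtain ⟨s, t, hu, hv⟩ := isRotated_iff_exists_append.1 h
  rcases Nat.even_or_odd s.length with hs | hs
  · have ht : Odd t.length := by
      have hlen := congrArg List.length hu
      simp only [List.length_cons, length_mu, List.length_append] at hlen
      grind
    obtain ⟨p, k, hp⟩ := exists_eq_replicate_of_cons_mu_eq_append hv hu ht
    exact ⟨p, k, .inr hp⟩
  · obtain ⟨p, k, hp⟩ := exists_eq_replicate_of_cons_mu_eq_append hu hv hs
    exact ⟨p, k, .inl hp⟩

theorem isFactor_cons_concat_of_cons_cons (hlen : 4 ≤ v.length)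
    (hl : IsFactor thueMorse (b :: b :: v)) (hr : IsFactor thueMorse (v ++ [a])) :
    IsFactor thueMorse (b :: (v ++ [a])) := by
  obtain ⟨i, hi⟩ := hl
  obtain ⟨j, hj⟩ := hr
  simp only [List.length_cons, factorAt_succ, List.cons.injEq] at hi
  obtain ⟨rfl, hi, hv⟩ := hi
  rw [List.length_append, List.length_singleton, factorAt_succ'] at hj
  obtain ⟨hv', ha⟩ := List.append_inj' hj rfl
  by_contra hforbidden
  rw [List.singleton_inj] at ha
  have hodd := (odd_and_even_of_not_isFactor hlen (hv.trans hv'.symm)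
    (by rwa [hi, ha, hv])).1
  obtain ⟨i, rfl⟩ : Even i := by grind
  rw [← two_mul, thueMorse_two_mul_add_one, thueMorse_two_mul] at hi
  exact rev_ne _ hi

/-- The pairs `(a, u)` with `u` of length `m` for which `mu u ++ [a]` or `a :: mu u` is read off the
image under `mu` of a factor of length `m + 1`; they parametrise the classes of factors of length
`2 * m + 1`. -/
def readings (m : ℕ) : Set (Fin 2 × List (Fin 2)) :=
  (fun x => x.2 ++ [x.1]) ⁻¹' factors thueMorse (m + 1) ∪
    (fun x => x.1.rev :: x.2) ⁻¹' factors thueMorse (m + 1)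

theorem mem_readings_iff : (a, u) ∈ readings m ↔
    u.length = m ∧ (IsFactor thueMorse (u ++ [a]) ∨ IsFactor thueMorse (a.rev :: u)) := by
  simp [readings, mem_factors_iff, and_or_left]

theorem concat_injective :
    Function.Injective fun x : Fin 2 × List (Fin 2) => x.2 ++ [x.1] := by
  rintro ⟨a, u⟩ ⟨b, v⟩ h
  simpa [and_comm] using h

theorem rev_cons_injective :
    Function.Injective fun x : Fin 2 × List (Fin 2) => x.1.rev :: x.2 := by
  rintro ⟨a, u⟩ ⟨b, v⟩ h
  simpa using h

theorem rev_cons_concat_injective :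
    Function.Injective fun x : Fin 2 × List (Fin 2) => x.1.rev :: (x.2 ++ [x.1]) :=
  fun _ _ h => concat_injective (List.cons.inj h).2

theorem rev_cons_concat_mem_distinctEnds (hu : u.length = m)
    (h : IsFactor thueMorse (a.rev :: (u ++ [a]))) :
    a.rev :: (u ++ [a]) ∈ distinctEnds thueMorse (m + 2) :=
  ⟨mem_factors_iff.2 ⟨by simp [hu], h⟩, by
    rw [← List.cons_append, List.getLast?_concat]; simp⟩

theorem two_mul_factorComplexity_le : 2 * factorComplexity thueMorse (m + 1) ≤
    (readings m).ncard + distinctEndsComplexity thueMorse (m + 2) +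
      (minimalForbidden thueMorse (m + 2)).ncard := by
  have hconcat : ((fun x : Fin 2 × List (Fin 2) => x.2 ++ [x.1]) ⁻¹'
      factors thueMorse (m + 1)).ncard = factorComplexity thueMorse (m + 1) := by
    refine Set.ncard_preimage_of_injective_subset_range concat_injective ?_
    rintro _ ⟨i, rfl⟩
    exact ⟨(thueMorse (i + m), factorAt thueMorse m i), factorAt_succ'.symm⟩
  have hcons : ((fun x : Fin 2 × List (Fin 2) => x.1.rev :: x.2) ⁻¹'
      factors thueMorse (m + 1)).ncard = factorComplexity thueMorse (m + 1) := by
    refine Set.ncard_preimage_of_injective_subset_range rev_cons_injective ?_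
    rintro _ ⟨i, rfl⟩
    exact ⟨((thueMorse i).rev, factorAt thueMorse m (i + 1)), by
      simp only [Fin.rev_rev, factorAt_succ]⟩
  have hinter : ((fun x : Fin 2 × List (Fin 2) => x.2 ++ [x.1]) ⁻¹' factors thueMorse (m + 1) ∩
      (fun x => x.1.rev :: x.2) ⁻¹' factors thueMorse (m + 1)).ncard ≤
      (distinctEnds thueMorse (m + 2) ∪ minimalForbidden thueMorse (m + 2)).ncard := by
    refine Set.ncard_le_ncard_of_injOn (fun x => x.1.rev :: (x.2 ++ [x.1])) ?_
      rev_cons_concat_injective.injOn (finite_distinctEnds.union finite_minimalForbidden)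
    rintro ⟨a, u⟩ ⟨hr, hl⟩
    simp only [Set.mem_preimage, mem_factors_iff] at hr hl
    by_cases h : IsFactor thueMorse (a.rev :: (u ++ [a]))
    · exact .inl (rev_cons_concat_mem_distinctEnds (by simpa using hr.1) h)
    · exact .inr ⟨by simpa using hr.1,
        by rw [← List.cons_append, List.dropLast_concat]; exact hl.2, hr.2, h⟩
  have hunion := Set.ncard_union_add_ncard_inter _ _
    ((finite_factors (x := thueMorse) (n := m + 1)).preimage concat_injective.injOn)
    ((finite_factors (x := thueMorse) (n := m + 1)).preimage rev_cons_injective.injOn)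
  rw [hconcat, hcons] at hunion
  have hsum : (distinctEnds thueMorse (m + 2) ∪ minimalForbidden thueMorse (m + 2)).ncard ≤
    distinctEndsComplexity thueMorse (m + 2) + _ := Set.ncard_union_le _ _
  rw [readings]
  omega

/-- The pairs `(a, v)` such that `(a, v ++ [a])` and `(a, a.rev :: v)`, which give the same cyclic
word, are both readings. -/
def links (m : ℕ) : Set (Fin 2 × List (Fin 2)) :=
  {x | (x.1, x.2 ++ [x.1]) ∈ readings m ∧ (x.1, x.1.rev :: x.2) ∈ readings m}

theorem mapsTo_links (hm : 4 ≤ m) :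
    Set.MapsTo (fun x => x.1.rev :: (x.2 ++ [x.1])) (links (m + 1))
      (distinctEnds thueMorse (m + 2)) := by
  rintro ⟨a, v⟩ ⟨hr, hl⟩
  rw [mem_readings_iff] at hr hl
  obtain ⟨hlen, hl⟩ := hl
  rw [List.length_cons, add_left_inj] at hlen
  refine rev_cons_concat_mem_distinctEnds hlen ?_
  obtain hr | hr := hr.2
  · exact hl.elim id fun hl => isFactor_cons_concat_of_cons_cons (by omega) hl hr.left
  · exact hr

/-- The readings that remain after removing one end of each link. -/
def reducedReadings (m : ℕ) : Set (Fin 2 × List (Fin 2)) :=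
  readings m \ (fun x => (x.1, x.2 ++ [x.1])) '' links m

theorem ncard_readings_le (hm : 4 ≤ m) : (readings (m + 1)).ncard ≤
    (reducedReadings (m + 1)).ncard + distinctEndsComplexity thueMorse (m + 2) := by
  have hfin : (links (m + 1)).Finite :=
    Set.Finite.of_injOn (mapsTo_links hm) rev_cons_concat_injective.injOn finite_distinctEnds
  calc (readings (m + 1)).ncard
    _ ≤ (reducedReadings (m + 1)).ncard + ((fun x => (x.1, x.2 ++ [x.1])) '' links (m + 1)).ncard :=
      Set.ncard_le_ncard_sdiff_add_ncard _ _ (hfin.image _)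
    _ ≤ (reducedReadings (m + 1)).ncard + distinctEndsComplexity thueMorse (m + 2) :=
      Nat.add_le_add_left ((Set.ncard_image_le hfin).trans <|
        Set.ncard_le_ncard_of_injOn _ (mapsTo_links hm) rev_cons_concat_injective.injOn
          finite_distinctEnds) _

theorem eq_of_mem_reducedReadings (h : (a, v ++ List.replicate k a) ∈ reducedReadings m)
    (h' : (a, List.replicate k a.rev ++ v) ∈ readings m) :
    v ++ List.replicate k a = List.replicate k a.rev ++ v := by
  have hlink {p : List (Fin 2)} (hp : v ++ List.replicate k a = p ++ [a]) :
      (a, a.rev :: p) ∉ readings m := fun hmem => h.2 ⟨(a, p), ⟨hp ▸ h.1, hmem⟩, by rw [hp]⟩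
  have hfactor := (mem_readings_iff.1 h').2
  obtain rfl | rfl | rfl | hk := show k = 0 ∨ k = 1 ∨ k = 2 ∨ 3 ≤ k by omega
  · simp
  · exact absurd h' (hlink rfl)
  · refine absurd (mem_readings_iff.2 ⟨?_, .inr ?_⟩) (hlink (p := v ++ [a]) (by simp))
    · simpa [add_comm] using (mem_readings_iff.1 h').1
    · exact hfactor.resolve_right not_isFactor_cons_cube
  · have := length_le_of_isFactor_replicate (k := k) (a := a.rev)
      (hfactor.elim (fun h => h.left.left) fun h => IsFactor.left (IsFactor.right (u := [_]) h))
    omega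

theorem ncard_reducedReadings_le :
    (reducedReadings m).ncard ≤ cyclicComplexity thueMorse (2 * m + 1) := by
  refine Set.ncard_le_ncard_of_injOn (fun x => ((x.1 :: mu x.2 : List (Fin 2)) : Cycle (Fin 2)))
    ?_ ?_ (cyclicFactors_finite _ _)
  · rintro ⟨a, u⟩ ⟨⟨i, hi⟩ | ⟨i, hi⟩, -⟩ <;> dsimp only at hi ⊢
    · refine ⟨2 * i, Cycle.coe_eq_coe.2 ?_⟩
      rw [factorAt_two_mul_add_one_two_mul, hi, mu_append, mu_cons, mu_nil, List.append_cons,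
        List.dropLast_concat]
      exact List.isRotated_concat _ _
    · refine ⟨2 * i + 1, ?_⟩
      dsimp only
      rw [factorAt_two_mul_add_one_two_mul_add_one, hi, mu_cons, List.tail_cons, Fin.rev_rev]
  · rintro ⟨a, u⟩ hu ⟨b, v⟩ hv h
    replace h : a :: mu u ~r b :: mu v := Cycle.coe_eq_coe.1 h
    obtain rfl : b = a := by
      by_contra hne
      have hcount := h.perm.count_eq a
      rw [List.count_cons, List.count_cons, count_mu, count_mu, (mem_readings_iff.1 hu.1).1,
        (mem_readings_iff.1 hv.1).1] at hcount
      simp [hne] at hcount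
    obtain ⟨p, k, ⟨rfl, rfl⟩ | ⟨rfl, rfl⟩⟩ := exists_eq_replicate_of_cons_mu_isRotated h
    · rw [eq_of_mem_reducedReadings hu hv.1]
    · rw [eq_of_mem_reducedReadings hv hu.1]

theorem two_mul_factorComplexity_le_cyclicComplexity (hm : 5 ≤ m) :
    2 * factorComplexity thueMorse (m + 1) ≤ cyclicComplexity thueMorse (2 * m + 1) +
      distinctEndsComplexity thueMorse (m + 1) + distinctEndsComplexity thueMorse (m + 2) +
      (minimalForbidden thueMorse (m + 2)).ncard := by
  obtain ⟨l, rfl⟩ := Nat.exists_eq_add_of_le' (show 1 ≤ m by omega)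
  have := two_mul_factorComplexity_le (m := l + 1)
  have : _ ≤ _ + distinctEndsComplexity thueMorse (l + 1 + 1) :=
    ncard_readings_le (show 4 ≤ l by omega)
  have := ncard_reducedReadings_le (m := l + 1)
  omega

end OddLength

section Imbalance

variable {m n i j r : ℕ}

/-- The number of factors of length `n + 1` with distinct ends minus the number of those with equal
ends. Shifting the length by one makes the recursion compatible with halving `n`. -/
noncomputable def imbalance (n : ℕ) : ℤ :=
  2 * distinctEndsComplexity thueMorse (n + 1) - factorComplexity thueMorse (n + 1)

theorem imbalance_two_mul (hn : 2 ≤ n) : imbalance (2 * n) = 2 * imbalance n := by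
  rw [imbalance, imbalance, distinctEndsComplexity_two_mul_add_one hn,
    factorComplexity_two_mul_add_one hn]
  push_cast
  ring

theorem imbalance_two_mul_add_one (hn : 1 ≤ n) :
    imbalance (2 * n + 1) = -(imbalance n + imbalance (n + 1)) := by
  have hD := distinctEndsComplexity_two_mul (Nat.succ_le_succ hn)
  have hp := factorComplexity_two_mul (Nat.succ_le_succ hn)
  simp only [imbalance, show 2 * n + 1 + 1 = 2 * (n + 1) by ring]
  simp only [Nat.succ_eq_add_one] at hD hp
  omega

theorem imbalance_two : imbalance 2 = 2 := by
  rw [imbalance, distinctEndsComplexity_three, factorComplexity_three]; rfl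

theorem imbalance_three : imbalance 3 = -2 := by
  rw [imbalance_two_mul_add_one le_rfl, imbalance_two, imbalance, distinctEndsComplexity_two,
    factorComplexity_two]; rfl

theorem imbalance_four : imbalance 4 = 4 := by
  rw [imbalance_two_mul le_rfl, imbalance_two]; rfl

/-- The sum of two consecutive imbalances: up to sign it is the imbalance at `2 * n + 1`, and it
measures the deviation of `distinctEndsComplexity thueMorse (2 * n + 2)` from half the number of
factors. -/
noncomputable def imbalanceSum (n : ℕ) : ℤ := imbalance n + imbalance (n + 1)

/-- The difference of two consecutive imbalances, which forms a closed system of recursions together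
with `imbalanceSum`. -/
noncomputable def imbalanceDiff (n : ℕ) : ℤ := imbalance n - imbalance (n + 1)

theorem imbalanceSum_two_mul (hn : 2 ≤ n) : imbalanceSum (2 * n) = imbalanceDiff n := by
  rw [imbalanceSum, imbalanceDiff, imbalance_two_mul hn, imbalance_two_mul_add_one (by omega)]
  ring

theorem imbalanceSum_two_mul_add_one (hn : 2 ≤ n) :
    imbalanceSum (2 * n + 1) = -imbalanceDiff n := by
  rw [imbalanceSum, imbalanceDiff, imbalance_two_mul_add_one (by omega),
    show 2 * n + 1 + 1 = 2 * (n + 1) by ring, imbalance_two_mul (by omega)]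
  ring

theorem imbalanceDiff_two_mul (hn : 2 ≤ n) :
    imbalanceDiff (2 * n) = imbalanceDiff n + 2 * imbalanceSum n := by
  rw [imbalanceSum, imbalanceDiff, imbalanceDiff, imbalance_two_mul hn,
    imbalance_two_mul_add_one (by omega)]
  ring

theorem imbalanceDiff_two_mul_add_one (hn : 2 ≤ n) :
    imbalanceDiff (2 * n + 1) = imbalanceDiff n - 2 * imbalanceSum n := by
  rw [imbalanceSum, imbalanceDiff, imbalanceDiff, imbalance_two_mul_add_one (by omega),
    show 2 * n + 1 + 1 = 2 * (n + 1) by ring, imbalance_two_mul (by omega)]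
  ring

theorem imbalanceSum_two : imbalanceSum 2 = 0 := by
  rw [imbalanceSum, imbalance_two, imbalance_three]; rfl

theorem imbalanceDiff_two : imbalanceDiff 2 = 4 := by
  rw [imbalanceDiff, imbalance_two, imbalance_three]; rfl

theorem imbalanceSum_three : imbalanceSum 3 = 2 := by
  rw [imbalanceSum, imbalance_three, imbalance_four]; rfl

theorem imbalanceDiff_three : imbalanceDiff 3 = -6 := by
  rw [imbalanceDiff, imbalance_three, imbalance_four]; rfl

theorem abs_imbalanceSum (hn : 4 ≤ n) : |imbalanceSum n| = |imbalanceDiff (n / 2)| := by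
  obtain ⟨k, rfl | rfl⟩ := n.even_or_odd'
  · rw [imbalanceSum_two_mul (by omega), show 2 * k / 2 = k by omega]
  · rw [imbalanceSum_two_mul_add_one (by omega), show (2 * k + 1) / 2 = k by omega, abs_neg]

theorem abs_imbalanceDiff_le (hn : 4 ≤ n) :
    |imbalanceDiff n| ≤ |imbalanceDiff (n / 2)| + 2 * |imbalanceSum (n / 2)| := by
  obtain ⟨k, rfl | rfl⟩ := n.even_or_odd'
  · rw [imbalanceDiff_two_mul (by omega), show 2 * k / 2 = k by omega]
    exact (abs_add_le _ _).trans_eq (by rw [abs_mul, abs_two])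
  · rw [imbalanceDiff_two_mul_add_one (by omega), show (2 * k + 1) / 2 = k by omega]
    exact (abs_sub _ _).trans_eq (by rw [abs_mul, abs_two])

theorem abs_imbalanceSum_le (hn : 8 ≤ n) :
    |imbalanceSum n| ≤ |imbalanceDiff (n / 4)| + 2 * |imbalanceSum (n / 4)| := by
  rw [abs_imbalanceSum (by omega), show n / 4 = n / 2 / 2 by omega]
  exact abs_imbalanceDiff_le (by omega)

-- `(2 ^ i - (-1) ^ i) / 3` are the Jacobsthal numbers, the solution of `s' = d`, `d' = d + 2 * s`.
theorem three_mul_abs_imbalance_le {c : ℤ} {q : ℕ} (hq : 2 ≤ q)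
    (hsum : 3 * |imbalanceSum q| ≤ c * (2 ^ i - (-1) ^ i))
    (hdiff : 3 * |imbalanceDiff q| ≤ c * (2 ^ (i + 1) + (-1) ^ i)) (hn : n / 2 ^ j = q) :
    3 * |imbalanceSum n| ≤ c * (2 ^ (i + j) - (-1) ^ (i + j)) ∧
      3 * |imbalanceDiff n| ≤ c * (2 ^ (i + j + 1) + (-1) ^ (i + j)) := by
  induction j generalizing n with
  | zero =>
    obtain rfl : n = q := by simpa using hn
    exact ⟨hsum, hdiff⟩
  | succ j ih =>
    obtain ⟨ihsum, ihdiff⟩ := ih (n := n / 2) (by rw [Nat.div_div_eq_div_mul, ← pow_succ', hn])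
    have hn4 : 4 ≤ n := by
      have : 2 ≤ n / 2 := hq.trans (hn ▸ by
        rw [pow_succ', ← Nat.div_div_eq_div_mul]
        exact Nat.div_le_self _ _)
      omega
    rw [abs_imbalanceSum hn4, ← add_assoc]
    constructor
    · refine ihdiff.trans_eq ?_
      ring
    · calc 3 * |imbalanceDiff n|
        _ ≤ 3 * |imbalanceDiff (n / 2)| + 2 * (3 * |imbalanceSum (n / 2)|) := by
          linarith [abs_imbalanceDiff_le hn4]
        _ ≤ c * (2 ^ (i + j + 1) + (-1) ^ (i + j)) + 2 * (c * (2 ^ (i + j) - (-1) ^ (i + j))) := by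
          gcongr
        _ = c * (2 ^ (i + j + 1 + 1) + (-1) ^ (i + j + 1)) := by ring

theorem three_mul_imbalanceSum_le_of_lt (hl : 2 * 2 ^ j ≤ n) (hu : n < 3 * 2 ^ j) :
    3 * imbalanceSum n ≤ 4 * (2 ^ j - (-1) ^ j) := by
  have hn : n / 2 ^ j = 2 := Nat.div_eq_of_lt_le hl hu
  have h := (three_mul_abs_imbalance_le (c := 4) (i := 0) le_rfl
    (by norm_num [imbalanceSum_two]) (by norm_num [imbalanceDiff_two]) hn).1
  rw [zero_add] at h
  linarith [le_abs_self (imbalanceSum n)]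

theorem three_mul_imbalanceSum_le_of_le (hl : 3 * 2 ^ j ≤ n) (hu : n < 4 * 2 ^ j) :
    3 * imbalanceSum n ≤ 8 * 2 ^ j - 2 * (-1) ^ j := by
  have hn : n / 2 ^ j = 3 := Nat.div_eq_of_lt_le hl hu
  have h := (three_mul_abs_imbalance_le (c := 2) (i := 2) (by norm_num)
    (by norm_num [imbalanceSum_three]) (by norm_num [imbalanceDiff_three]) hn).1
  rw [pow_add, pow_add] at h
  linarith [le_abs_self (imbalanceSum n)]

theorem imbalance_three_mul_two_pow_nonpos :
    imbalanceSum (3 * 2 ^ (i + 1)) ≤ 0 ∧ imbalanceDiff (3 * 2 ^ (i + 1)) ≤ 0 := by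
  induction i with
  | zero =>
    rw [show 3 * 2 ^ (0 + 1) = 2 * 3 by rfl, imbalanceSum_two_mul (by omega),
      imbalanceDiff_two_mul (by omega), imbalanceSum_three, imbalanceDiff_three]
    norm_num
  | succ i ih =>
    have hi : 2 ≤ 3 * 2 ^ (i + 1) := by grind [Nat.one_le_two_pow (n := i + 1)]
    rw [show 3 * 2 ^ (i + 1 + 1) = 2 * (3 * 2 ^ (i + 1)) by ring, imbalanceSum_two_mul hi,
      imbalanceDiff_two_mul hi]
    omega

end Imbalance

section NearPowers

variable {m i r : ℕ}

theorem imbalance_two_mul_two_pow :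
    3 * imbalanceSum (2 * 2 ^ i) = 4 * 2 ^ i - 4 * (-1) ^ i ∧
      3 * imbalanceDiff (2 * 2 ^ i) = 8 * 2 ^ i + 4 * (-1) ^ i := by
  induction i with
  | zero => simp [imbalanceSum_two, imbalanceDiff_two]
  | succ i ih =>
    have hi : 2 ≤ 2 * 2 ^ i := by grind [Nat.one_le_two_pow (n := i)]
    rw [pow_succ' 2 i, imbalanceSum_two_mul hi, imbalanceDiff_two_mul hi, pow_succ, pow_succ]
    omega

theorem imbalance_four_mul_two_pow_sub_one :
    3 * imbalanceSum (4 * 2 ^ i - 1) = 8 * 2 ^ i - 2 * (-1) ^ i ∧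
      3 * imbalanceDiff (4 * 2 ^ i - 1) = -(16 * 2 ^ i + 2 * (-1) ^ i) := by
  induction i with
  | zero => simp [imbalanceSum_three, imbalanceDiff_three]
  | succ i ih =>
    have hi := Nat.one_le_two_pow (n := i)
    rw [show 4 * 2 ^ (i + 1) - 1 = 2 * (4 * 2 ^ i - 1) + 1 by grind,
      imbalanceSum_two_mul_add_one (by omega), imbalanceDiff_two_mul_add_one (by omega), pow_succ,
      pow_succ]
    omega

theorem abs_imbalanceDiff_four_mul_two_pow_add_one : |imbalanceDiff (4 * 2 ^ i + 1)| = 4 := by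
  have hi := Nat.one_le_two_pow (n := i)
  obtain ⟨hsum, hdiff⟩ := imbalance_two_mul_two_pow (i := i)
  have h : imbalanceDiff (4 * 2 ^ i + 1) = 4 * (-1) ^ i := by
    rw [show 4 * 2 ^ i + 1 = 2 * (2 * 2 ^ i) + 1 by ring, imbalanceDiff_two_mul_add_one (by omega)]
    linarith
  rw [h, abs_mul, abs_neg_one_pow]
  rfl

theorem abs_imbalanceDiff_eight_mul_two_pow_sub_two : |imbalanceDiff (8 * 2 ^ i - 2)| = 2 := by
  have hi := Nat.one_le_two_pow (n := i)
  obtain ⟨hsum, hdiff⟩ := imbalance_four_mul_two_pow_sub_one (i := i)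
  have h : imbalanceDiff (8 * 2 ^ i - 2) = -2 * (-1) ^ i := by
    rw [show 8 * 2 ^ i - 2 = 2 * (4 * 2 ^ i - 1) by omega, imbalanceDiff_two_mul (by omega)]
    linarith
  rw [h, abs_mul, abs_neg_one_pow]
  rfl

theorem three_mul_imbalanceSum_eight_mul_two_pow_sub_two :
    3 * imbalanceSum (8 * 2 ^ i - 2) = -(16 * 2 ^ i + 2 * (-1) ^ i) := by
  have hi := Nat.one_le_two_pow (n := i)
  rw [show 8 * 2 ^ i - 2 = 2 * (4 * 2 ^ i - 1) by omega, imbalanceSum_two_mul (by omega)]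
  exact imbalance_four_mul_two_pow_sub_one.2

theorem three_mul_imbalanceSum_two_pow_add_le (hr : 1 ≤ r) (hr' : r ≤ 6) :
    3 * imbalanceSum (32 * 2 ^ i + r) ≤ 64 * 2 ^ i + 8 * r - 52 := by
  have hi := Nat.one_le_two_pow (n := i)
  have hi' : (1 : ℤ) ≤ 2 ^ i := one_le_pow₀ one_le_two
  have habs := le_abs_self (imbalanceSum (32 * 2 ^ i + r))
  have hsign := neg_one_pow_eq_or ℤ i
  obtain rfl | ⟨hr, hr'⟩ | hr := show r = 1 ∨ (2 ≤ r ∧ r ≤ 3) ∨ 4 ≤ r by omega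
  · have hdiff := (imbalance_two_mul_two_pow (i := i + 3)).2
    rw [show 32 * 2 ^ i + 1 = 2 * (2 * 2 ^ (i + 3)) + 1 by ring,
      imbalanceSum_two_mul_add_one (by grind)]
    rw [pow_add (2 : ℤ), pow_add (-1 : ℤ)] at hdiff
    omega
  · rw [abs_imbalanceSum (by omega),
      show (32 * 2 ^ i + r) / 2 = 4 * 2 ^ (i + 2) + 1 by rw [pow_add]; omega,
      abs_imbalanceDiff_four_mul_two_pow_add_one] at habs
    omega
  · have hle := abs_imbalanceSum_le (n := 32 * 2 ^ i + r) (by omega)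
    have hdiff := (imbalance_two_mul_two_pow (i := i + 1)).2
    have hsmall : 4 + (-1) ^ (i + 1) ≤ 4 * (2 : ℤ) ^ i := by
      cases i with
      | zero => norm_num
      | succ i => grind [neg_one_pow_eq_or ℤ (i + 2), one_le_pow₀ (n := i) (one_le_two (α := ℤ))]
    rw [show (32 * 2 ^ i + r) / 4 = 4 * 2 ^ (i + 1) + 1 by rw [pow_succ]; omega,
      abs_imbalanceDiff_four_mul_two_pow_add_one,
      abs_imbalanceSum (n := 4 * 2 ^ (i + 1) + 1) (by grind),
      show (4 * 2 ^ (i + 1) + 1) / 2 = 2 * 2 ^ (i + 1) by omega,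
      abs_of_pos (a := imbalanceDiff _) (by grind)] at hle
    rw [pow_succ (2 : ℤ)] at hdiff
    omega

theorem three_mul_imbalanceSum_two_pow_sub_le_of_le (hr : 2 ≤ r) (hr' : r ≤ 5) :
    3 * imbalanceSum (32 * 2 ^ i - r) ≤ 64 * 2 ^ i + 4 * r - 46 := by
  have hi := Nat.one_le_two_pow (n := i)
  have hi' : (1 : ℤ) ≤ 2 ^ i := one_le_pow₀ one_le_two
  have hsign := neg_one_pow_eq_or ℤ i
  obtain rfl | ⟨hr, hr'⟩ | rfl := show r = 2 ∨ (3 ≤ r ∧ r ≤ 4) ∨ r = 5 by omega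
  · have hdiff := (imbalance_four_mul_two_pow_sub_one (i := i + 2)).2
    rw [show 32 * 2 ^ i - 2 = 2 * (4 * 2 ^ (i + 2) - 1) by grind, imbalanceSum_two_mul (by grind)]
    rw [pow_add (2 : ℤ), pow_add (-1 : ℤ)] at hdiff
    omega
  · have habs := le_abs_self (imbalanceSum (32 * 2 ^ i - r))
    rw [abs_imbalanceSum (by omega),
      show (32 * 2 ^ i - r) / 2 = 8 * 2 ^ (i + 1) - 2 by rw [pow_succ]; omega,
      abs_imbalanceDiff_eight_mul_two_pow_sub_two] at habs
    omega
  · have hsum := three_mul_imbalanceSum_eight_mul_two_pow_sub_two (i := i)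
    have hdiff := neg_abs_le (imbalanceDiff (8 * 2 ^ i - 2))
    rw [abs_imbalanceDiff_eight_mul_two_pow_sub_two] at hdiff
    rw [show 32 * 2 ^ i - 5 = 2 * (2 * (8 * 2 ^ i - 2) + 1) + 1 by omega,
      imbalanceSum_two_mul_add_one (by omega), imbalanceDiff_two_mul_add_one (by omega)]
    omega

theorem three_mul_imbalanceSum_two_pow_sub_le_of_ge (hr : 6 ≤ r) (hr' : r ≤ 11)
    (hri : r ≤ 8 * 2 ^ i) :
    3 * imbalanceSum (32 * 2 ^ i - r) ≤ 64 * 2 ^ i + 4 * r - 46 := by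
  have hi := Nat.one_le_two_pow (n := i)
  have hi' : (1 : ℤ) ≤ 2 ^ i := one_le_pow₀ one_le_two
  have hsign := neg_one_pow_eq_or ℤ i
  have habs := le_abs_self (imbalanceSum (32 * 2 ^ i - r))
  have hle := abs_imbalanceSum_le (n := 32 * 2 ^ i - r) (by omega)
  obtain hr' | hr := le_or_gt r 8
  · have hsum := three_mul_imbalanceSum_eight_mul_two_pow_sub_two (i := i)
    rw [show (32 * 2 ^ i - r) / 4 = 8 * 2 ^ i - 2 by omega,
      abs_imbalanceDiff_eight_mul_two_pow_sub_two,
      abs_of_neg (a := imbalanceSum (8 * 2 ^ i - 2)) (by omega)] at hle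
    omega
  · obtain ⟨k, rfl⟩ : ∃ k, i = k + 1 :=
      Nat.exists_eq_succ_of_ne_zero (by rintro rfl; omega)
    have hk := Nat.one_le_two_pow (n := k)
    have hk' : (1 : ℤ) ≤ 2 ^ k := one_le_pow₀ one_le_two
    have hsum := three_mul_imbalanceSum_eight_mul_two_pow_sub_two (i := k)
    have hhalf : (8 * 2 ^ (k + 1) - 3) / 2 = 8 * 2 ^ k - 2 := by rw [pow_succ]; omega
    have hdiff := abs_imbalanceDiff_le (n := 8 * 2 ^ (k + 1) - 3) (by omega)
    rw [show (32 * 2 ^ (k + 1) - r) / 4 = 8 * 2 ^ (k + 1) - 3 by omega,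
      abs_imbalanceSum (n := 8 * 2 ^ (k + 1) - 3) (by omega), hhalf,
      abs_imbalanceDiff_eight_mul_two_pow_sub_two] at hle
    rw [hhalf, abs_imbalanceDiff_eight_mul_two_pow_sub_two,
      abs_of_neg (a := imbalanceSum (8 * 2 ^ k - 2)) (by grind)] at hdiff
    rw [pow_succ (2 : ℤ)]
    rw [pow_succ] at hsign
    omega

theorem three_mul_imbalanceSum_two_pow_sub_le (hr : 2 ≤ r) (hr' : r ≤ 11) (hri : r ≤ 8 * 2 ^ i) :
    3 * imbalanceSum (32 * 2 ^ i - r) ≤ 64 * 2 ^ i + 4 * r - 46 := by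
  obtain h | h := le_or_gt r 5
  · exact three_mul_imbalanceSum_two_pow_sub_le_of_le hr h
  · exact three_mul_imbalanceSum_two_pow_sub_le_of_ge h hr' hri

end NearPowers

section LowerBounds

variable {m n j : ℕ}

theorem factorComplexity_add_two_mul_two_pow (hl : 2 * 2 ^ j ≤ m) (hu : m ≤ 4 * 2 ^ j) :
    factorComplexity thueMorse (m + 1) + 2 * 2 ^ j = min (4 * m) (2 * m + 6 * 2 ^ j) := by
  induction j generalizing m with
  | zero =>
    obtain rfl | rfl | rfl : m = 2 ∨ m = 3 ∨ m = 4 := by omega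
    · rw [factorComplexity_three]; rfl
    · rw [show 3 + 1 = 2 * 2 by rfl, factorComplexity_two_mul le_rfl, factorComplexity_two,
        factorComplexity_three]; rfl
    · rw [factorComplexity_two_mul_add_one le_rfl, factorComplexity_three]; rfl
  | succ j ih =>
    have hj := Nat.one_le_two_pow (n := j)
    rw [pow_succ] at hl hu ⊢
    obtain ⟨k, rfl | rfl⟩ := m.even_or_odd'
    · rw [factorComplexity_two_mul_add_one (by omega)]
      have := ih (m := k) (by omega) (by omega)
      omega
    · rw [show 2 * k + 1 + 1 = 2 * (k + 1) by ring, factorComplexity_two_mul (by omega)]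
      have := ih (m := k) (by omega) (by omega)
      have := ih (m := k + 1) (by omega) (by omega)
      omega

theorem exists_two_pow_trichotomy (hm : 2 ≤ m) :
    ∃ j, (2 * 2 ^ j ≤ m ∧ m < 3 * 2 ^ j) ∨ m = 3 * 2 ^ j ∨ (3 * 2 ^ j < m ∧ m < 4 * 2 ^ j) := by
  obtain ⟨j, hj⟩ : ∃ j, Nat.log 2 m = j + 1 :=
    Nat.exists_eq_succ_of_ne_zero (Nat.log_pos one_lt_two hm).ne'
  have hl := Nat.pow_log_le_self 2 (show m ≠ 0 by omega)
  have hu := Nat.lt_pow_succ_log_self one_lt_two m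
  rw [hj, pow_succ] at hl hu
  rw [pow_succ] at hu
  exact ⟨j, by omega⟩

theorem distinctEndsComplexity_two_mul_add_two (hm : 1 ≤ m) :
    distinctEndsComplexity thueMorse (2 * m + 2) +
        (distinctEndsComplexity thueMorse (m + 1) + distinctEndsComplexity thueMorse (m + 2)) =
      factorComplexity thueMorse (m + 1) + factorComplexity thueMorse (m + 2) := by
  simpa only [mul_add, add_assoc] using
    distinctEndsComplexity_two_mul (show 2 ≤ m + 1 from Nat.succ_le_succ hm)

theorem two_mul_distinctEndsComplexity_add_imbalanceSum (hm : 1 ≤ m) :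
    2 * (distinctEndsComplexity thueMorse (2 * m + 2) : ℤ) + imbalanceSum m =
      factorComplexity thueMorse (m + 1) + factorComplexity thueMorse (m + 2) := by
  have h := distinctEndsComplexity_two_mul_add_two hm
  simp only [imbalanceSum, imbalance, add_assoc, Nat.reduceAdd]
  omega

theorem six_mul_distinctEndsComplexity_of_lt (hl : 2 * 2 ^ j ≤ m) (hu : m < 3 * 2 ^ j) :
    6 * (distinctEndsComplexity thueMorse (2 * m + 2) : ℤ) =
      24 * m - 12 * 2 ^ j + 12 - 3 * imbalanceSum m := by
  have hj := Nat.one_le_two_pow (n := j)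
  have hD := two_mul_distinctEndsComplexity_add_imbalanceSum (m := m) (by omega)
  have hp := factorComplexity_add_two_mul_two_pow (m := m) hl (by omega)
  have hp' := factorComplexity_add_two_mul_two_pow (j := j) (m := m + 1) (by omega) (by omega)
  rw [min_eq_left (by omega)] at hp hp'
  zify at hp hp'
  linarith

theorem six_mul_distinctEndsComplexity_of_le (hl : 3 * 2 ^ j ≤ m) (hu : m < 4 * 2 ^ j) :
    6 * (distinctEndsComplexity thueMorse (2 * m + 2) : ℤ) =
      12 * m + 24 * 2 ^ j + 6 - 3 * imbalanceSum m := by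
  have hj := Nat.one_le_two_pow (n := j)
  have hD := two_mul_distinctEndsComplexity_add_imbalanceSum (m := m) (by omega)
  have hp := factorComplexity_add_two_mul_two_pow (j := j) (m := m) (by omega) (by omega)
  have hp' := factorComplexity_add_two_mul_two_pow (j := j) (m := m + 1) (by omega) (by omega)
  rw [min_eq_right (by omega)] at hp hp'
  zify at hp hp'
  linarith

theorem le_three_mul_distinctEndsComplexity_two_mul_add_two (hm : 2 ≤ m) :
    8 * m + 4 ≤ 3 * distinctEndsComplexity thueMorse (2 * m + 2) := by
  obtain ⟨j, hj⟩ := exists_two_pow_trichotomy hm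
  have hsign := neg_one_pow_eq_or ℤ j
  obtain ⟨hl, hu⟩ | ⟨hl, hu⟩ :
      (2 * 2 ^ j ≤ m ∧ m < 3 * 2 ^ j) ∨ 3 * 2 ^ j ≤ m ∧ m < 4 * 2 ^ j := by omega
  · have hD := six_mul_distinctEndsComplexity_of_lt hl hu
    have hsum := three_mul_imbalanceSum_le_of_lt hl hu
    zify at hl hu ⊢
    omega
  · have hD := six_mul_distinctEndsComplexity_of_le hl hu
    have hsum := three_mul_imbalanceSum_le_of_le hl hu
    zify at hl hu ⊢
    omega

theorem le_three_mul_distinctEndsComplexity_add_one (hn : 3 ≤ n) :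
    4 * n ≤ 3 * distinctEndsComplexity thueMorse (n + 1) := by
  induction n using Nat.strong_induction_on with
  | _ n ih =>
    obtain ⟨m, rfl | rfl⟩ := n.even_or_odd'
    · rw [distinctEndsComplexity_two_mul_add_one (by omega)]
      obtain rfl | hm : m = 2 ∨ 3 ≤ m := by omega
      · rw [distinctEndsComplexity_three]; decide
      · grind
    · obtain rfl | hm : m = 1 ∨ 2 ≤ m := by omega
      · have h := distinctEndsComplexity_two_mul_add_two le_rfl
        simp only [Nat.reduceAdd, Nat.reduceMul, distinctEndsComplexity_two,
          distinctEndsComplexity_three, factorComplexity_two, factorComplexity_three] at h ⊢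
        omega
      · exact (by omega : _ ≤ 8 * m + 4).trans
          (le_three_mul_distinctEndsComplexity_two_mul_add_two hm)

theorem factorComplexity_add_distinctEndsComplexity_le (hm : 5 ≤ m) :
    factorComplexity thueMorse (m + 1) + distinctEndsComplexity thueMorse (2 * m + 2) ≤
      cyclicComplexity thueMorse (2 * m + 1) + factorComplexity thueMorse (m + 2) +
        (minimalForbidden thueMorse (m + 2)).ncard := by
  have h := two_mul_factorComplexity_le_cyclicComplexity hm
  have hD := distinctEndsComplexity_two_mul_add_two (m := m) (by omega)
  omega

theorem minimalForbidden_eq_empty (hl : 2 * 2 ^ j ≤ m) (hu : m < 4 * 2 ^ j) (hne : m ≠ 3 * 2 ^ j) :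
    minimalForbidden thueMorse (m + 2) = ∅ := by
  by_contra! h
  have hj := Nat.one_le_two_pow (n := j)
  obtain ⟨i, rfl⟩ := exists_eq_three_mul_two_pow_of_minimalForbidden_nonempty (by omega) h
  obtain hij | rfl | hij := lt_trichotomy i j
  · have := Nat.pow_le_pow_right two_pos hij
    rw [pow_succ] at this
    omega
  · exact hne rfl
  · have := Nat.pow_le_pow_right two_pos hij
    rw [pow_succ] at this
    omega

theorem le_six_mul_cyclicComplexity_of_lt (hm : 5 ≤ m) (hl : 2 * 2 ^ j ≤ m) (hu : m < 3 * 2 ^ j) :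
    24 * (m : ℤ) - 12 * 2 ^ j - 12 ≤
      6 * cyclicComplexity thueMorse (2 * m + 1) + 3 * imbalanceSum m := by
  have hD := six_mul_distinctEndsComplexity_of_lt hl hu
  have hc := factorComplexity_add_distinctEndsComplexity_le hm
  have hp := factorComplexity_add_two_mul_two_pow (m := m) hl (by omega)
  have hp' := factorComplexity_add_two_mul_two_pow (j := j) (m := m + 1) (by omega) (by omega)
  rw [minimalForbidden_eq_empty hl (by omega) (by omega), Set.ncard_empty] at hc
  rw [min_eq_left (by omega)] at hp hp'
  zify at hc hp hp'
  linarith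

theorem le_six_mul_cyclicComplexity_of_gt (hm : 5 ≤ m) (hl : 3 * 2 ^ j < m) (hu : m < 4 * 2 ^ j) :
    12 * (m : ℤ) + 24 * 2 ^ j - 6 ≤
      6 * cyclicComplexity thueMorse (2 * m + 1) + 3 * imbalanceSum m := by
  have hD := six_mul_distinctEndsComplexity_of_le hl.le hu
  have hc := factorComplexity_add_distinctEndsComplexity_le hm
  have hp := factorComplexity_add_two_mul_two_pow (j := j) (m := m) (by omega) (by omega)
  have hp' := factorComplexity_add_two_mul_two_pow (j := j) (m := m + 1) (by omega) (by omega)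
  rw [minimalForbidden_eq_empty (j := j) (by omega) hu hl.ne', Set.ncard_empty] at hc
  rw [min_eq_right (by omega)] at hp hp'
  zify at hc hp hp'
  linarith

theorem le_cyclicComplexity_of_eq (hm : 5 ≤ m) (hmj : m = 3 * 2 ^ j) :
    10 * 2 ^ j ≤ cyclicComplexity thueMorse (2 * m + 1) + 5 ∧
      10 * 2 ^ j + 1 ≤ distinctEndsComplexity thueMorse (2 * m + 2) := by
  obtain ⟨i, rfl⟩ : ∃ i, j = i + 1 := Nat.exists_eq_succ_of_ne_zero (by rintro rfl; omega)
  have hsum := (imbalance_three_mul_two_pow_nonpos (i := i)).1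
  have hD := six_mul_distinctEndsComplexity_of_le hmj.ge (by omega)
  have hc := factorComplexity_add_distinctEndsComplexity_le hm
  have hM := ncard_minimalForbidden_le (m := m) (by omega)
  have hp := factorComplexity_add_two_mul_two_pow (j := i + 1) (m := m) (by omega) (by omega)
  have hp' := factorComplexity_add_two_mul_two_pow (j := i + 1) (m := m + 1) (by omega) (by omega)
  rw [← hmj] at hsum
  rw [min_eq_right (by omega)] at hp hp'
  zify at hc hp hp' hM hmj ⊢
  constructor <;> linarith

theorem le_cyclicComplexity_two_mul_add_one (hm : 6 ≤ m) :
    4 * (2 * m + 1) ≤ 3 * cyclicComplexity thueMorse (2 * m + 1) + 12 := by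
  obtain ⟨j, ⟨hl, hu⟩ | hmj | ⟨hl, hu⟩⟩ := exists_two_pow_trichotomy (m := m) (by omega)
  · have hc := le_six_mul_cyclicComplexity_of_lt (by omega) hl hu
    have hsum := three_mul_imbalanceSum_le_of_lt hl hu
    have hsign := neg_one_pow_eq_or ℤ j
    zify at hl hu ⊢
    omega
  · have := le_cyclicComplexity_of_eq (by omega) hmj
    omega
  · have hc := le_six_mul_cyclicComplexity_of_gt (by omega) hl hu
    have hsum := three_mul_imbalanceSum_le_of_le hl.le hu
    have hsign := neg_one_pow_eq_or ℤ j
    zify at hl hu ⊢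
    omega

theorem le_cyclicComplexity_add_distinctEndsComplexity (hm : 6 ≤ m) (hJ : 2 * m + 1 ∉ setJ) :
    16 * m + 2 ≤ 3 * cyclicComplexity thueMorse (2 * m + 1) +
      3 * distinctEndsComplexity thueMorse (2 * m + 2) := by
  obtain ⟨j, ⟨hl, hu⟩ | hmj | ⟨hl, hu⟩⟩ := exists_two_pow_trichotomy (m := m) (by omega)
  · have hc := le_six_mul_cyclicComplexity_of_lt (by omega) hl hu
    have hD := six_mul_distinctEndsComplexity_of_lt hl hu
    have hsum := three_mul_imbalanceSum_le_of_lt hl hu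
    have hsign : (-1 : ℤ) ^ j = 1 ∨ 2 * 2 ^ j + 1 ≤ m ∧ (-1 : ℤ) ^ j = -1 := by
      obtain hj | hj := j.even_or_odd
      · exact .inl hj.neg_one_pow
      · refine .inr ⟨lt_of_le_of_ne hl ?_, hj.neg_one_pow⟩
        rintro rfl
        obtain ⟨i, rfl⟩ := hj
        exact hJ ⟨i + 1, 0, Nat.le_add_left 1 i, by ring⟩
    zify at hl hu hsign ⊢
    omega
  · have := le_cyclicComplexity_of_eq (by omega) hmj
    omega
  · have hc := le_six_mul_cyclicComplexity_of_gt (by omega) hl hu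
    have hD := six_mul_distinctEndsComplexity_of_le hl.le hu
    have hsum := three_mul_imbalanceSum_le_of_le hl.le hu
    have hsign := neg_one_pow_eq_or ℤ j
    zify at hl hu ⊢
    omega

theorem le_cyclicComplexity_of_lt_of_notMem_setB (hm : 23 ≤ m) (hl : 2 * 2 ^ j ≤ m)
    (hu : m < 3 * 2 ^ j) (hB : 2 * m + 1 ∉ setB) :
    4 * (2 * m + 1) + 16 ≤ 3 * cyclicComplexity thueMorse (2 * m + 1) := by
  obtain ⟨i, rfl⟩ : ∃ i, j = i + 3 := by
    refine Nat.exists_eq_add_of_le' (?_ : 2 < j)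
    exact (Nat.pow_lt_pow_iff_right one_lt_two).1 (by omega)
  obtain ⟨r, rfl⟩ := Nat.exists_eq_add_of_le hl
  have hr : r ≠ 0 := by
    rintro rfl
    exact hB ⟨i + 5, by omega, by ring⟩
  have hc := le_six_mul_cyclicComplexity_of_lt (by omega) hl hu
  obtain hr' | hr' := le_or_gt r 6
  · obtain ⟨k, rfl⟩ : ∃ k, i = k + 1 := Nat.exists_eq_succ_of_ne_zero (by rintro rfl; omega)
    have hsum := three_mul_imbalanceSum_two_pow_add_le (i := k) (by omega) hr'
    have hpow : 2 ^ (k + 1 + 3) = 16 * 2 ^ k := by ring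
    rw [show 32 * 2 ^ k = 2 * 2 ^ (k + 1 + 3) by omega] at hsum
    zify at hpow ⊢
    push_cast at hc
    omega
  · have hsum := three_mul_imbalanceSum_le_of_lt hl hu
    have hsign := neg_one_pow_eq_or ℤ (i + 3)
    zify
    push_cast at hc
    omega

theorem le_cyclicComplexity_of_gt_of_notMem_setA (hm : 23 ≤ m) (hl : 3 * 2 ^ j < m)
    (hu : m < 4 * 2 ^ j) (hA : 2 * m + 1 ∉ setA) :
    4 * (2 * m + 1) + 16 ≤ 3 * cyclicComplexity thueMorse (2 * m + 1) := by
  obtain ⟨i, rfl⟩ : ∃ i, j = i + 3 := by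
    refine Nat.exists_eq_add_of_le' (?_ : 2 < j)
    exact (Nat.pow_lt_pow_iff_right one_lt_two).1 (by omega)
  have hpow : 2 ^ (i + 3) = 8 * 2 ^ i := by ring
  obtain ⟨r, hr⟩ := Nat.exists_eq_add_of_le hu.le
  have hr0 : r ≠ 1 := by
    rintro rfl
    exact hA ⟨i + 6, by omega, by rw [pow_add]; omega⟩
  have hc := le_six_mul_cyclicComplexity_of_gt (by omega) hl hu
  obtain hr' | hr' := le_or_gt r 11
  · have hsum := three_mul_imbalanceSum_two_pow_sub_le (r := r) (i := i) (by omega) hr' (by omega)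
    rw [show 32 * 2 ^ i - r = m by omega] at hsum
    zify at hr hpow ⊢
    omega
  · have hsum := three_mul_imbalanceSum_le_of_le hl.le hu
    have hsign := neg_one_pow_eq_or ℤ (i + 3)
    zify at hr ⊢
    omega

theorem le_cyclicComplexity_of_notMem (hm : 23 ≤ m) (hAB : 2 * m + 1 ∉ setA ∪ setB) :
    4 * (2 * m + 1) + 16 ≤ 3 * cyclicComplexity thueMorse (2 * m + 1) := by
  obtain ⟨j, ⟨hl, hu⟩ | hmj | ⟨hl, hu⟩⟩ := exists_two_pow_trichotomy (m := m) (by omega)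
  · exact le_cyclicComplexity_of_lt_of_notMem_setB hm hl hu fun hB => hAB (.inr hB)
  · have := le_cyclicComplexity_of_eq (by omega) hmj
    omega
  · exact le_cyclicComplexity_of_gt_of_notMem_setA hm hl hu fun hA => hAB (.inl hA)

end LowerBounds

section Conclusion

variable {n m : ℕ}

/-- The cyclic factors of length `n` that occur at the first 64 positions of the Thue-Morse word, a
computable lower approximation of `cyclicFactors thueMorse n`. -/
def prefixClasses (n : ℕ) : Finset (Cycle (Fin 2)) :=
  (Finset.range 64).image fun i => (factorAt thueMorse n i : Cycle (Fin 2))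

theorem card_prefixClasses_le : (prefixClasses n).card ≤ cyclicComplexity thueMorse n := by
  rw [cyclicComplexity, ← Set.ncard_coe_finset, prefixClasses, Finset.coe_image]
  exact Set.ncard_le_ncard (Set.image_subset_range _ _) (cyclicFactors_finite _ _)

theorem le_card_prefixClasses : ∀ n < 12, 4 * n ≤ 3 * (prefixClasses n).card + 12 ∧
    (n ≠ 5 → n ≠ 9 → 4 * n ≤ 3 * (prefixClasses n).card + 6) := by
  decide +kernel

theorem le_cyclicComplexity_of_lt (hn : n < 12) : 4 * n ≤ 3 * cyclicComplexity thueMorse n + 12 ∧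
    (n ≠ 5 → n ≠ 9 → 4 * n ≤ 3 * cyclicComplexity thueMorse n + 6) := by
  grw [← card_prefixClasses_le]
  exact le_card_prefixClasses n hn

theorem le_cyclicComplexity (n : ℕ) : 4 * n ≤ 3 * cyclicComplexity thueMorse n + 12 := by
  induction n using Nat.strong_induction_on with
  | _ n ih =>
    obtain hn | hn := lt_or_ge n 12
    · exact (le_cyclicComplexity_of_lt hn).1
    obtain ⟨m, rfl | rfl⟩ := n.even_or_odd'
    · have hc := cyclicComplexity_add_distinctEndsComplexity_le (m := m) (by omega)
      have hD := le_three_mul_distinctEndsComplexity_add_one (n := m) (by omega)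
      have := ih m (by omega)
      omega
    · exact le_cyclicComplexity_two_mul_add_one (by omega)

theorem two_mul_mem_setJ (h : n ∈ setJ) : 2 * n ∈ setJ := by
  obtain ⟨i, j, hi, rfl⟩ := h
  exact ⟨i, j + 1, hi, by ring⟩

theorem le_cyclicComplexity_of_even (hn : Even n) (hJ : n ∉ setJ) :
    4 * n ≤ 3 * cyclicComplexity thueMorse n + 6 := by
  induction n using Nat.strong_induction_on with
  | _ n ih =>
    obtain hn12 | hn12 := lt_or_ge n 12
    · exact (le_cyclicComplexity_of_lt hn12).2 (by grind) (by grind)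
    obtain ⟨m, rfl⟩ := hn.two_dvd
    replace hJ : m ∉ setJ := fun h => hJ (two_mul_mem_setJ h)
    have hc := cyclicComplexity_add_distinctEndsComplexity_le (m := m) (by omega)
    have hD := le_three_mul_distinctEndsComplexity_add_one (n := m) (by omega)
    obtain hm | hm | ⟨hm, hm'⟩ : Even m ∨ m < 12 ∨ ¬ Even m ∧ 12 ≤ m := by grind
    · have := ih m (by omega) hm hJ
      omega
    · have := (le_cyclicComplexity_of_lt hm).2 (by omega) fun h => hJ ⟨1, 0, le_rfl, h⟩
      omega
    · obtain ⟨k, rfl⟩ := Nat.not_even_iff_odd.1 hm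
      have := le_cyclicComplexity_add_distinctEndsComplexity (by omega) hJ
      simp only [add_assoc, Nat.reduceAdd] at hc
      omega

end Conclusion

end ThueMorse

theorem theorem5 :
    (∀ n : ℕ, (4 / 3 : ℝ) * (n : ℝ) - 4 ≤ (cyclicComplexity thueMorse n : ℝ)) ∧
    (∀ n : ℕ, Even n → n ∉ setJ →
      (4 / 3 : ℝ) * (n : ℝ) - 2 ≤ (cyclicComplexity thueMorse n : ℝ)) ∧
    (∀ n : ℕ, Odd n → 47 ≤ n → n ∉ setA ∪ setB →
      (4 * (n : ℝ) + 16) / 3 ≤ (cyclicComplexity thueMorse n : ℝ)) := by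
  refine ⟨fun n => ?_, fun n hn hJ => ?_, fun n hn h47 hAB => ?_⟩
  · have h : (4 * n : ℝ) ≤ 3 * cyclicComplexity thueMorse n + 12 := by
      exact_mod_cast ThueMorse.le_cyclicComplexity n
    linarith
  · have h : (4 * n : ℝ) ≤ 3 * cyclicComplexity thueMorse n + 6 := by
      exact_mod_cast ThueMorse.le_cyclicComplexity_of_even hn hJ
    linarith
  · obtain ⟨m, rfl⟩ := hn
    have h : (4 * (2 * m + 1) + 16 : ℝ) ≤ 3 * cyclicComplexity thueMorse (2 * m + 1) := by
      exact_mod_cast ThueMorse.le_cyclicComplexity_of_notMem (by omega) hAB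
    push_cast
    linarith
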